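/- Conventions. A chain is a linearly ordered set $(C,<)$. It is scattered if $(\mathbb Q,<)$ does not embed into it. Having Hausdorff degree at most $n$ $(n<\omega)$ is defined inductively: $C$ has degree at most $0$ iff $C$ is finite, and degree at most $n+1$ iff $C=\sum_{i\in I}C_i$ is an ordered sum of chains $C_i$ of degree at most $n$ over a linearly ordered index set $I$ that is well-ordered or inversely well-ordered. A chain is tame if it is scattered and has finite Hausdorff degree, i.e. degree at most $n$ for some $n<\omega$. A definable well-ordering of $C$ is a well-ordering of the elements of $C$ of the form $\{(x,y)\in C^2 : (C,<)\models\varphi(x,y,\bar P)\}$, where $\varphi$ is a formula of the monadic second-order language of order (quantification over elements and over arbitrary subsets of $C$) and the parameters $\bar P$ are finitely many subsets of $C$. For a nonempty tame chain $C$, put $\mathrm{Log}(C)=\infty$ iff $C$ has a definable well-ordering of order type $\ge\omega^\omega$, and, for $k<\omega$, $\mathrm{Log}(C)=k$ iff $C$ has a definable well-ordering of order type $\alpha$ with $\omega^k\le\alpha<\omega^{k+1}$. Proposition 4.8. For every nonempty tame chain $C$, $\mathrm{Log}(C)$ is well defined: there is exactly one value $v\in\omega\cup\{\infty\}$ with $\mathrm{Log}(C)=v$.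 Moreover, either there is $k<\omega$ such that all definable well-orderings of $C$ have order type in $[\omega^k,\omega^{k+1})$, or all definable well-orderings of $C$ have order type $\ge\omega^\omega$. -/

import Mathlib

universe u

/-- Formulas of the monadic second-order language of order with `n` free element variables and
`m` free set variables, both in de Bruijn style: a quantifier binds variable `0` of its sort. -/
inductive MSOFormula : ℕ → ℕ → Type
  | eq {n m : ℕ} (x y : Fin n) : MSOFormula n m
  | lt {n m : ℕ} (x y : Fin n) : MSOFormula n m
  | mem {n m : ℕ} (x : Fin n) (X : Fin m) : MSOFormula n m
  | neg {n m : ℕ} (φ : MSOFormula n m) : MSOFormula n m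
  | and {n m : ℕ} (φ ψ : MSOFormula n m) : MSOFormula n m
  | exElem {n m : ℕ} (φ : MSOFormula (n + 1) m) : MSOFormula n m
  | exSet {n m : ℕ} (φ : MSOFormula n (m + 1)) : MSOFormula n m

/-- Satisfaction in a chain `C`: set variables range over all subsets of `C`. -/
def MSOFormula.Sat {C : Type u} [LinearOrder C] :
    {n m : ℕ} → MSOFormula n m → (Fin n → C) → (Fin m → Set C) → Prop
  | _, _, .eq x y, v, _ => v x = v y
  | _, _, .lt x y, v, _ => v x < v y
  | _, _, .mem x X, v, V => v x ∈ V X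
  | _, _, .neg φ, v, V => ¬ φ.Sat v V
  | _, _, .and φ ψ, v, V => φ.Sat v V ∧ ψ.Sat v V
  | n, _, .exElem φ, v, V => ∃ a : C, φ.Sat (Fin.cons a v : Fin (n + 1) → C) V
  | _, m, .exSet φ, v, V => ∃ A : Set C, φ.Sat v (Fin.cons A V : Fin (m + 1) → Set C)

/-- The binary relation `r` on the chain `C` is defined by a monadic second-order formula
`φ(x, y, P̄)`, where `P̄` is a finite sequence of subsets of `C` used as parameters. -/
def MSODefinable (C : Type u) [LinearOrder C] (r : C → C → Prop) : Prop :=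
  ∃ (m : ℕ) (φ : MSOFormula 2 m) (P : Fin m → Set C), ∀ x y : C, r x y ↔ φ.Sat ![x, y] P

/-- Some monadic second-order formula with parameters defines a (strict) well-ordering of the
elements of the chain `C` whose order type is `o`. -/
def HasDefinableWellOrderOfType (C : Type u) [LinearOrder C] (o : Ordinal.{u}) : Prop :=
  ∃ (r : C → C → Prop) (_ : IsWellOrder C r), MSODefinable C r ∧ Ordinal.type r = o

/-- A chain is scattered if the rationals do not embed into it. -/
def IsScattered (C : Type u) [LinearOrder C] : Prop :=
  ¬ ∃ f : ℚ → C, StrictMono f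

/-- `HdegLE n C` says that the Hausdorff degree of `C` is at most `n`. The chains of degree `0` are
the finite ones, and `C` has degree at most `n + 1` iff it is an ordered sum `∑_{i ∈ I} C_i` of
chains of degree at most `n`, with `I` well-ordered or inversely well-ordered. A decomposition of
`C` as an ordered sum over `I` is given by the monotone map sending each element to its index; the
summands are the fibres. -/
def HdegLE : ℕ → ∀ (C : Type u) [LinearOrder C], Prop
  | 0, C, _ => Finite C
  | n + 1, C, _ => ∃ (I : Type u) (_ : LinearOrder I) (f : C → I),
      (WellFoundedLT I ∨ WellFoundedGT I) ∧ Monotone f ∧ ∀ i : I, HdegLE n {x : C // f x = i}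

/-- A chain is tame if it is scattered and its Hausdorff degree is finite. -/
def IsTameChain (C : Type u) [LinearOrder C] : Prop :=
  IsScattered C ∧ ∃ n : ℕ, HdegLE n C

/-- The relation `Log(C) = v`, for `v ∈ ω ∪ {∞}`: `Log(C) = ∞` iff some definable well-ordering
of `C` has order type `≥ ω^ω`, and `Log(C) = k` iff some definable well-ordering of `C` has order
type in `[ω^k, ω^(k+1))`. -/
def IsLog (C : Type u) [LinearOrder C] (v : ℕ∞) : Prop :=
  (v = ⊤ ∧ ∃ o : Ordinal.{u}, HasDefinableWellOrderOfType C o ∧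
    Ordinal.omega0 ^ Ordinal.omega0 ≤ o) ∨
  ∃ k : ℕ, v = (k : ℕ∞) ∧ ∃ o : Ordinal.{u}, HasDefinableWellOrderOfType C o ∧
    Ordinal.omega0 ^ (k : Ordinal.{u}) ≤ o ∧ o < Ordinal.omega0 ^ ((k + 1 : ℕ) : Ordinal.{u})

/-! Existence and uniqueness are separate arguments. A definable well-ordering comes from finite
Hausdorff degree: by induction on the degree, the summands are well-ordered lexicographically and
compared with one another along the index set or against it. The partition into summands is coded by
a single subset that alternates so often along the index set that two points share a summand iff the
subset is constant between them.

For uniqueness, definable relations are seen only through the composition theorem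
(`msoType_univ_eq_of_fibers`): whether `r x y` holds depends on finitely many colours of the
segments cut out around `x` and `y` (`PiecewiseDetermined`). Order types are replaced by the
combinatorial notion `IsOmegaPowLarge r k S`, which on the whole chain means type at least `ω ^ k`
(`isOmegaPowLarge_univ_iff`) and which passes to a member of any finite cover. By Ramsey's theorem,
a monotone sequence of points cuts out intervals that can be joined into homogeneous blocks. Hence
infinitely many consecutive `k`-large intervals have a `(k + 1)`-large union, and conversely a `(k +
1)`-large union has a `k`-large member.

The core is `PiecewiseDetermined.large_of_large`: in a countable chain, two such well-orderings `r`,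
`s` make the same convex sets `k`-large for `k ≥ 1`. Suppose `S` is not `(k + 1)`-large for `r`.
Identify points whose interval is not `k`-large for `r`. Only finitely many classes meet `S`, since
otherwise a monotone sequence of inequivalent points would make `S` large. If `S` were `(k +
1)`-large for `s`, so would be one class, and countability would give two of its points with a
`k`-large interval for `s`, hence by induction for `r`, which is absurd. Countability is free: a
chain with a well-ordering of type below some `ω ^ k` is countable. So all definable well-orderings
lie below the same powers `ω ^ k`. -/

/-! ### Monadic types and the composition theorem. -/

/-- Monadic types of depth `d` over a set `ι` of names for subsets. -/
def MSOType : ℕ → Type → Type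
  | 0, ι => ι → ι → Prop × Prop
  | d + 1, ι => Set (MSOType d (Option ι))

instance MSOType.finite : ∀ (d : ℕ) (ι : Type) [Finite ι], Finite (MSOType d ι)
  | 0, ι, _ => inferInstanceAs (Finite (ι → ι → Prop × Prop))
  | d + 1, ι, _ =>
    have := MSOType.finite d (Option ι)
    inferInstanceAs (Finite (Set (MSOType d (Option ι))))

/-- Add one more set to a family of sets. -/
def extendFamily {C : Type u} {ι : Type} (X : Set C) (W : ι → Set C) : Option ι → Set C :=
  fun o => o.elim X W

/-- The depth `d` monadic type of the subchain `S` with the subsets `W i ∩ S`. -/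
def msoType {C : Type u} [LinearOrder C] (S : Set C) :
    (d : ℕ) → {ι : Type} → (ι → Set C) → MSOType d ι
  | 0, _, W => fun i j =>
      (∃ x ∈ S, x ∈ W i ∧ x ∈ W j, ∃ x ∈ S, ∃ y ∈ S, x ∈ W i ∧ y ∈ W j ∧ x < y)
  | d + 1, _, W => Set.range fun X : Set C => msoType S d (extendFamily X W)

section MSOType

variable {C : Type u} [LinearOrder C]

theorem msoType_zero_eq_iff {S S' : Set C} {ι : Type} {W W' : ι → Set C} :
    msoType S 0 W = msoType S' 0 W' ↔ ∀ i j,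
      ((∃ x ∈ S, x ∈ W i ∧ x ∈ W j) ↔ ∃ x ∈ S', x ∈ W' i ∧ x ∈ W' j) ∧
      ((∃ x ∈ S, ∃ y ∈ S, x ∈ W i ∧ y ∈ W j ∧ x < y) ↔
        ∃ x ∈ S', ∃ y ∈ S', x ∈ W' i ∧ y ∈ W' j ∧ x < y) := by
  constructor
  · intro h i j
    have := congrFun (congrFun h i) j
    simpa [msoType] using this
  · intro h
    funext i j
    simpa [msoType] using h i j

theorem msoType_succ_eq_iff {S S' : Set C} {d : ℕ} {ι : Type} {W W' : ι → Set C} :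
    msoType S (d + 1) W = msoType S' (d + 1) W' ↔
      (∀ X, ∃ Y, msoType S d (extendFamily X W) = msoType S' d (extendFamily Y W')) ∧
      ∀ Y, ∃ X, msoType S d (extendFamily X W) = msoType S' d (extendFamily Y W') := by
  constructor
  · intro h
    have h : (Set.range fun X : Set C => msoType S d (extendFamily X W)) =
      Set.range fun X : Set C => msoType S' d (extendFamily X W') := h
    constructor
    · intro X
      obtain ⟨Y, hY⟩ := h.le ⟨X, rfl⟩
      exact ⟨Y, hY.symm⟩
    · intro Y
      obtain ⟨X, hX⟩ := h.ge ⟨Y, rfl⟩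
      exact ⟨X, hX⟩
  · rintro ⟨h₁, h₂⟩
    apply Set.Subset.antisymm
    · rintro _ ⟨X, rfl⟩
      obtain ⟨Y, hY⟩ := h₁ X
      exact ⟨Y, hY.symm⟩
    · rintro _ ⟨Y, rfl⟩
      obtain ⟨X, hX⟩ := h₂ Y
      exact ⟨X, hX⟩

theorem msoType_eq_of_succ {S S' : Set C} {d : ℕ} {ι : Type} {W W' : ι → Set C}
    (h : msoType S (d + 1) W = msoType S' (d + 1) W') : msoType S d W = msoType S' d W' := by
  induction d generalizing ι with
  | zero =>
    obtain ⟨Y, hY⟩ := (msoType_succ_eq_iff.1 h).1 ∅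
    rw [msoType_zero_eq_iff] at hY ⊢
    exact fun i j => hY (some i) (some j)
  | succ d ih =>
    rw [msoType_succ_eq_iff] at h ⊢
    exact ⟨fun X => (h.1 X).imp fun Y hY => ih hY, fun Y => (h.2 Y).imp fun X hX => ih hX⟩

theorem msoType_eq_of_le {S S' : Set C} {d e : ℕ} (hde : d ≤ e) {ι : Type} {W W' : ι → Set C}
    (h : msoType S e W = msoType S' e W') : msoType S d W = msoType S' d W' := by
  induction e, hde using Nat.le_induction with
  | base => exact h
  | succ e _ ih => exact ih (msoType_eq_of_succ h)

theorem msoType_congr {S : Set C} {d : ℕ} {ι : Type} {W W' : ι → Set C}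
    (h : ∀ i, ∀ x ∈ S, x ∈ W i ↔ x ∈ W' i) : msoType S d W = msoType S d W' := by
  induction d generalizing ι with
  | zero =>
    rw [msoType_zero_eq_iff]
    refine fun i j => ⟨exists_congr fun x => and_congr_right fun hx => ?_,
      exists_congr fun x => and_congr_right fun hx =>
        exists_congr fun y => and_congr_right fun hy => ?_⟩
    · rw [h i x hx, h j x hx]
    · rw [h i x hx, h j y hy]
  | succ d ih =>
    rw [msoType_succ_eq_iff]
    have key : ∀ X, msoType S d (extendFamily X W) = msoType S d (extendFamily X W') := by
      refine fun X => ih fun o x hx => ?_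
      cases o with
      | none => rfl
      | some i => exact h i x hx
    exact ⟨fun X => ⟨X, key X⟩, fun X => ⟨X, key X⟩⟩

/-- Composition theorem: the type of an ordered sum is determined by the types of the summands. -/
theorem msoType_univ_eq_of_fibers {J : Type*} [LinearOrder J] {f f' : C → J} (hf : Monotone f)
    (hf' : Monotone f') {d : ℕ} {ι : Type} {W W' : ι → Set C}
    (h : ∀ j, msoType (f ⁻¹' {j}) d W = msoType (f' ⁻¹' {j}) d W') :
    msoType Set.univ d W = msoType Set.univ d W' := by
  induction d generalizing ι with
  | zero =>
    have meet : ∀ {f f' : C → J} {W W' : ι → Set C}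
        (_ : ∀ j, msoType (f ⁻¹' {j}) 0 W = msoType (f' ⁻¹' {j}) 0 W') (i i' : ι) (x : C),
        x ∈ W i → x ∈ W i' → ∃ y, f' y = f x ∧ y ∈ W' i ∧ y ∈ W' i' := by
      intro f f' W W' h i i' x hx hx'
      exact (msoType_zero_eq_iff.1 (h (f x)) i i').1.1 ⟨x, rfl, hx, hx'⟩
    have less : ∀ {f f' : C → J} {W W' : ι → Set C} (_ : Monotone f) (_ : Monotone f')
        (_ : ∀ j, msoType (f ⁻¹' {j}) 0 W = msoType (f' ⁻¹' {j}) 0 W') (i i' : ι) (x y : C),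
        x ∈ W i → y ∈ W i' → x < y → ∃ x' y', x' ∈ W' i ∧ y' ∈ W' i' ∧ x' < y' := by
      intro f f' W W' hf hf' h i i' x y hx hy hxy
      rcases (hf hxy.le).lt_or_eq with hlt | heq
      · obtain ⟨x', hx'f, hx', -⟩ := meet h i i x hx hx
        obtain ⟨y', hy'f, hy', -⟩ := meet h i' i' y hy hy
        exact ⟨x', y', hx', hy', hf'.reflect_lt (by rwa [hx'f, hy'f])⟩
      · obtain ⟨x', -, y', -, h'⟩ :=
          (msoType_zero_eq_iff.1 (h (f x)) i i').2.1 ⟨x, rfl, y, heq.symm, hx, hy, hxy⟩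
        exact ⟨x', y', h'⟩
    rw [msoType_zero_eq_iff]
    refine fun i i' => ⟨⟨?_, ?_⟩, ⟨?_, ?_⟩⟩
    · rintro ⟨x, -, hx, hx'⟩
      obtain ⟨y, -, hy⟩ := meet h i i' x hx hx'
      exact ⟨y, trivial, hy⟩
    · rintro ⟨x, -, hx, hx'⟩
      obtain ⟨y, -, hy⟩ := meet (fun j => (h j).symm) i i' x hx hx'
      exact ⟨y, trivial, hy⟩
    · rintro ⟨x, -, y, -, hx, hy, hxy⟩
      obtain ⟨x', y', h'⟩ := less hf hf' h i i' x y hx hy hxy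
      exact ⟨x', trivial, y', trivial, h'⟩
    · rintro ⟨x, -, y, -, hx, hy, hxy⟩
      obtain ⟨x', y', h'⟩ := less hf' hf (fun j => (h j).symm) i i' x y hx hy hxy
      exact ⟨x', trivial, y', trivial, h'⟩
  | succ d ih =>
    have key : ∀ (f : C → J) (Z : J → Set C) (W : ι → Set C) (j : J),
        msoType (f ⁻¹' {j}) d (extendFamily {x | x ∈ Z (f x)} W) =
          msoType (f ⁻¹' {j}) d (extendFamily (Z j) W) := by
      intro f Z W j
      refine msoType_congr fun o x hx => ?_
      cases o with
      | none =>
        change x ∈ Z (f x) ↔ x ∈ Z j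
        rw [show f x = j from hx]
      | some i => rfl
    rw [msoType_succ_eq_iff]
    constructor
    · intro X
      -- The answers chosen fibre by fibre are glued along `f'` into one subset.
      choose Z hZ using fun j => (msoType_succ_eq_iff.1 (h j)).1 X
      exact ⟨{x | x ∈ Z (f' x)}, ih fun j => by rw [key f' Z W' j, hZ j]⟩
    · intro Y
      choose Z hZ using fun j => (msoType_succ_eq_iff.1 (h j)).2 Y
      exact ⟨{x | x ∈ Z (f x)}, ih fun j => by rw [key f Z W j, hZ j]⟩

/-- The quantifier depth of a formula. -/
def MSOFormula.depth : {n m : ℕ} → MSOFormula n m → ℕ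
  | _, _, .eq _ _ => 0
  | _, _, .lt _ _ => 0
  | _, _, .mem _ _ => 0
  | _, _, .neg φ => φ.depth
  | _, _, .and φ ψ => max φ.depth ψ.depth
  | _, _, .exElem φ => φ.depth + 1
  | _, _, .exSet φ => φ.depth + 1

/-- Depth `0` already detects singletons: the set is nonempty and contains no pair `x < y`. This
lets element quantifiers be treated as set quantifiers. -/
theorem exists_eq_singleton_of_msoType_eq {d : ℕ} {ι : Type} {W W' : ι → Set C}
    (h : msoType Set.univ d W = msoType Set.univ d W') {i : ι} {a : C} (ha : W i = {a}) :
    ∃ b, W' i = {b} := by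
  have h0 := msoType_zero_eq_iff.1 (msoType_eq_of_le (Nat.zero_le d) h) i i
  obtain ⟨b, -, hb, -⟩ := h0.1.1 ⟨a, trivial, by simp [ha]⟩
  refine ⟨b, Set.eq_singleton_iff_unique_mem.2 ⟨hb, fun c hc => ?_⟩⟩
  have h2 : ¬ ∃ x ∈ Set.univ, ∃ y ∈ Set.univ, x ∈ W' i ∧ y ∈ W' i ∧ x < y := by
    rw [← h0.2]
    rintro ⟨x, -, y, -, hx, hy, hxy⟩
    rw [ha] at hx hy
    exact hxy.ne (hx.trans hy.symm)
  by_contra hne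
  rcases lt_or_gt_of_ne hne with hlt | hlt
  · exact h2 ⟨c, trivial, b, trivial, hc, hb, hlt⟩
  · exact h2 ⟨b, trivial, c, trivial, hb, hc, hlt⟩

/-- Satisfaction of a formula is determined by the type whose depth is that of the formula. -/
theorem MSOFormula.sat_iff_of_msoType_eq {n m : ℕ} (φ : MSOFormula n m) :
    ∀ {ι : Type} {W W' : ι → Set C} (e : Fin n → ι) (s : Fin m → ι) {v v' : Fin n → C}
      {V V' : Fin m → Set C}, (∀ i, W (e i) = {v i}) → (∀ i, W' (e i) = {v' i}) →
      (∀ j, W (s j) = V j) → (∀ j, W' (s j) = V' j) →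
      msoType Set.univ φ.depth W = msoType Set.univ φ.depth W' → (φ.Sat v V ↔ φ.Sat v' V') := by
  induction φ with
  | eq x y =>
    intro ι W W' e s v v' V V' hv hv' _ _ h
    have := (msoType_zero_eq_iff.1 h (e x) (e y)).1
    simpa [MSOFormula.Sat, hv, hv'] using this
  | lt x y =>
    intro ι W W' e s v v' V V' hv hv' _ _ h
    have := (msoType_zero_eq_iff.1 h (e x) (e y)).2
    simpa [MSOFormula.Sat, hv, hv'] using this
  | mem x X =>
    intro ι W W' e s v v' V V' hv hv' hV hV' h
    have := (msoType_zero_eq_iff.1 h (e x) (s X)).1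
    simpa [MSOFormula.Sat, hv, hv', hV, hV'] using this
  | neg φ ih =>
    intro ι W W' e s v v' V V' hv hv' hV hV' h
    exact not_congr (ih e s hv hv' hV hV' h)
  | and φ ψ ih₁ ih₂ =>
    intro ι W W' e s v v' V V' hv hv' hV hV' h
    exact and_congr (ih₁ e s hv hv' hV hV' (msoType_eq_of_le (le_max_left _ _) h))
      (ih₂ e s hv hv' hV hV' (msoType_eq_of_le (le_max_right _ _) h))
  | @exElem n m φ ih =>
    intro ι W W' e s v v' V V' hv hv' hV hV' h
    have key : ∀ {W W' : ι → Set C} {v v' : Fin n → C} {V V' : Fin m → Set C},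
        (∀ i, W (e i) = {v i}) → (∀ i, W' (e i) = {v' i}) →
        (∀ j, W (s j) = V j) → (∀ j, W' (s j) = V' j) →
        msoType Set.univ (φ.depth + 1) W = msoType Set.univ (φ.depth + 1) W' →
        (MSOFormula.exElem φ).Sat v V → (MSOFormula.exElem φ).Sat v' V' := by
      rintro W W' v v' V V' hv hv' hV hV' h ⟨a, ha⟩
      obtain ⟨Y, hY⟩ := (msoType_succ_eq_iff.1 h).1 {a}
      obtain ⟨b, hb⟩ := exists_eq_singleton_of_msoType_eq hY (i := none) (a := a) rfl
      have hb : Y = {b} := hb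
      refine ⟨b, (ih (Fin.cons none fun i => some (e i)) (fun j => some (s j)) ?_ ?_ hV hV' hY).1
        ha⟩
      · exact fun i => Fin.cases rfl hv i
      · exact fun i => Fin.cases hb hv' i
    exact ⟨key hv hv' hV hV' h, key hv' hv hV' hV h.symm⟩
  | @exSet n m φ ih =>
    intro ι W W' e s v v' V V' hv hv' hV hV' h
    have key : ∀ {W W' : ι → Set C} {v v' : Fin n → C} {V V' : Fin m → Set C},
        (∀ i, W (e i) = {v i}) → (∀ i, W' (e i) = {v' i}) →
        (∀ j, W (s j) = V j) → (∀ j, W' (s j) = V' j) →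
        msoType Set.univ (φ.depth + 1) W = msoType Set.univ (φ.depth + 1) W' →
        (MSOFormula.exSet φ).Sat v V → (MSOFormula.exSet φ).Sat v' V' := by
      rintro W W' v v' V V' hv hv' hV hV' h ⟨A, hA⟩
      obtain ⟨Y, hY⟩ := (msoType_succ_eq_iff.1 h).1 A
      refine ⟨Y, (ih (fun i => some (e i)) (Fin.cons none fun j => some (s j)) hv hv' ?_ ?_ hY).1
        hA⟩
      · exact fun j => Fin.cases rfl hV j
      · exact fun j => Fin.cases rfl hV' j
    exact ⟨key hv hv' hV hV' h, key hv' hv hV' hV h.symm⟩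

/-! ### From definability to finite colourings of segments. -/

/-- A relation on a chain is piecewise determined if there are finitely many colours, for segments
and for segments with a distinguished element, such that cutting the chain into five consecutive
segments and choosing `x` in the second and `y` in the fourth one, the colours decide how `x` and
`y` are related. -/
def PiecewiseDetermined (r : C → C → Prop) : Prop :=
  ∃ (T : Type) (_ : Finite T) (τ : Set C → T) (σ : Set C → C → T),
    ∀ (f f' : C → Fin 5), Monotone f → Monotone f' → ∀ x y x' y' : C,
      f x = 1 → f y = 3 → f' x' = 1 → f' y' = 3 →
      τ (f ⁻¹' {0}) = τ (f' ⁻¹' {0}) → τ (f ⁻¹' {2}) = τ (f' ⁻¹' {2}) →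
      τ (f ⁻¹' {4}) = τ (f' ⁻¹' {4}) → σ (f ⁻¹' {1}) x = σ (f' ⁻¹' {1}) x' →
      σ (f ⁻¹' {3}) y = σ (f' ⁻¹' {3}) y' → (r x y ↔ r x' y') ∧ (r y x ↔ r y' x')

theorem MSODefinable.piecewiseDetermined {r : C → C → Prop} (hr : MSODefinable C r) :
    PiecewiseDetermined r := by
  obtain ⟨m, φ, P, hφ⟩ := hr
  let W : Set C → Set C → Fin 2 ⊕ Fin m → Set C := fun X Y => Sum.elim ![X, Y] P
  let T := MSOType φ.depth (Fin 2 ⊕ Fin m)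
  have hcongr : ∀ (S X Y X' Y' : Set C), (∀ x ∈ S, x ∈ X ↔ x ∈ X') → (∀ x ∈ S, x ∈ Y ↔ x ∈ Y') →
      msoType S φ.depth (W X Y) = msoType S φ.depth (W X' Y') := by
    intro S X Y X' Y' h₁ h₂
    refine msoType_congr fun i x hx => ?_
    rcases i with i | i
    · fin_cases i
      · exact h₁ x hx
      · exact h₂ x hx
    · rfl
  have hfib : ∀ (f : C → Fin 5) (x y : C) (X Y : Set C) (j : Fin 5),
      (∀ z, f z = j → (z = x ↔ z ∈ X)) → (∀ z, f z = j → (z = y ↔ z ∈ Y)) →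
      msoType (f ⁻¹' {j}) φ.depth (W {x} {y}) = msoType (f ⁻¹' {j}) φ.depth (W X Y) :=
    fun f x y X Y j h₁ h₂ => hcongr _ _ _ _ _ h₁ h₂
  have hsat : ∀ x y x' y' : C, msoType Set.univ φ.depth (W {x} {y}) =
      msoType Set.univ φ.depth (W {x'} {y'}) → (r x y ↔ r x' y') := by
    intro x y x' y' h
    rw [hφ, hφ]
    refine φ.sat_iff_of_msoType_eq (fun i => Sum.inl i) (fun j => Sum.inr j) ?_ ?_
      (fun _ => rfl) (fun _ => rfl) h
    · intro i; fin_cases i <;> rfl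
    · intro i; fin_cases i <;> rfl
  have hne : ∀ (f : C → Fin 5) (x z : C) (i j : Fin 5), f x = i → f z = j → i ≠ j →
      (z = x ↔ z ∈ (∅ : Set C)) := by
    rintro f x z i j rfl rfl h
    simp only [Set.mem_empty_iff_false, iff_false]
    rintro rfl
    exact h rfl
  -- A marked point may play the first or the second variable, so `σ` records both types; this
  -- serves `r x y` and `r y x` at once. The pair in `τ` is a duplicate that only makes the colour
  -- types agree.
  refine ⟨T × T, inferInstanceAs (Finite (MSOType _ _ × MSOType _ _)),
    fun S => (msoType S φ.depth (W ∅ ∅), msoType S φ.depth (W ∅ ∅)),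
    fun S x => (msoType S φ.depth (W {x} ∅), msoType S φ.depth (W ∅ {x})), ?_⟩
  intro f f' hf hf' x y x' y' hx hy hx' hy' h0 h2 h4 h1 h3
  simp only [Prod.mk.injEq, and_self] at h0 h2 h4 h1 h3
  constructor
  · refine hsat _ _ _ _ (msoType_univ_eq_of_fibers hf hf' fun j => ?_)
    fin_cases j
    · rw [hfib f x y ∅ ∅ _ (fun z hz => hne f x z _ _ hx hz (by decide))
        (fun z hz => hne f y z _ _ hy hz (by decide)),
        hfib f' x' y' ∅ ∅ _ (fun z hz => hne f' x' z _ _ hx' hz (by decide))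
        (fun z hz => hne f' y' z _ _ hy' hz (by decide))]
      exact h0
    · rw [hfib f x y {x} ∅ _ (fun z hz => Iff.rfl)
        (fun z hz => hne f y z _ _ hy hz (by decide)),
        hfib f' x' y' {x'} ∅ _ (fun z hz => Iff.rfl)
        (fun z hz => hne f' y' z _ _ hy' hz (by decide))]
      exact h1.1
    · rw [hfib f x y ∅ ∅ _ (fun z hz => hne f x z _ _ hx hz (by decide))
        (fun z hz => hne f y z _ _ hy hz (by decide)),
        hfib f' x' y' ∅ ∅ _ (fun z hz => hne f' x' z _ _ hx' hz (by decide))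
        (fun z hz => hne f' y' z _ _ hy' hz (by decide))]
      exact h2
    · rw [hfib f x y ∅ {y} _ (fun z hz => hne f x z _ _ hx hz (by decide))
        (fun z hz => Iff.rfl),
        hfib f' x' y' ∅ {y'} _ (fun z hz => hne f' x' z _ _ hx' hz (by decide))
        (fun z hz => Iff.rfl)]
      exact h3.2
    · rw [hfib f x y ∅ ∅ _ (fun z hz => hne f x z _ _ hx hz (by decide))
        (fun z hz => hne f y z _ _ hy hz (by decide)),
        hfib f' x' y' ∅ ∅ _ (fun z hz => hne f' x' z _ _ hx' hz (by decide))
        (fun z hz => hne f' y' z _ _ hy' hz (by decide))]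
      exact h4
  · refine hsat _ _ _ _ (msoType_univ_eq_of_fibers hf hf' fun j => ?_)
    fin_cases j
    · rw [hfib f y x ∅ ∅ _ (fun z hz => hne f y z _ _ hy hz (by decide))
        (fun z hz => hne f x z _ _ hx hz (by decide)),
        hfib f' y' x' ∅ ∅ _ (fun z hz => hne f' y' z _ _ hy' hz (by decide))
        (fun z hz => hne f' x' z _ _ hx' hz (by decide))]
      exact h0
    · rw [hfib f y x ∅ {x} _ (fun z hz => hne f y z _ _ hy hz (by decide))
        (fun z hz => Iff.rfl),
        hfib f' y' x' ∅ {x'} _ (fun z hz => hne f' y' z _ _ hy' hz (by decide))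
        (fun z hz => Iff.rfl)]
      exact h1.2
    · rw [hfib f y x ∅ ∅ _ (fun z hz => hne f y z _ _ hy hz (by decide))
        (fun z hz => hne f x z _ _ hx hz (by decide)),
        hfib f' y' x' ∅ ∅ _ (fun z hz => hne f' y' z _ _ hy' hz (by decide))
        (fun z hz => hne f' x' z _ _ hx' hz (by decide))]
      exact h2
    · rw [hfib f y x {y} ∅ _ (fun z hz => Iff.rfl)
        (fun z hz => hne f x z _ _ hx hz (by decide)),
        hfib f' y' x' {y'} ∅ _ (fun z hz => Iff.rfl)
        (fun z hz => hne f' x' z _ _ hx' hz (by decide))]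
      exact h3.1
    · rw [hfib f y x ∅ ∅ _ (fun z hz => hne f y z _ _ hy hz (by decide))
        (fun z hz => hne f x z _ _ hx hz (by decide)),
        hfib f' y' x' ∅ ∅ _ (fun z hz => hne f' y' z _ _ hy' hz (by decide))
        (fun z hz => hne f' x' z _ _ hx' hz (by decide))]
      exact h4

/-- Reversal swaps segments `0` with `4` and `1` with `3`, so it exchanges the roles of `x` and `y`;
this is why the definition controls both `r x y` and `r y x`. -/
theorem PiecewiseDetermined.dual {r : C → C → Prop} (hr : PiecewiseDetermined r) :
    PiecewiseDetermined (C := Cᵒᵈ) fun x y => r (OrderDual.ofDual x) (OrderDual.ofDual y) := by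
  obtain ⟨T, hT, τ, σ, h⟩ := hr
  refine ⟨T, hT, fun S => τ (OrderDual.toDual ⁻¹' S),
    fun S x => σ (OrderDual.toDual ⁻¹' S) (OrderDual.ofDual x), ?_⟩
  intro f f' hf hf' x y x' y' hx hy hx' hy' h0 h2 h4 h1 h3
  have hmono : ∀ f : Cᵒᵈ → Fin 5, Monotone f →
      Monotone fun z : C => Fin.rev (f (OrderDual.toDual z)) :=
    fun f hf a b hab => Fin.rev_le_rev.2 (hf hab)
  have hpre : ∀ (f : Cᵒᵈ → Fin 5) (j j' : Fin 5), j.rev = j' →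
      (fun z : C => Fin.rev (f (OrderDual.toDual z))) ⁻¹' {j} =
        OrderDual.toDual ⁻¹' (f ⁻¹' {j'}) := by
    rintro f j _ rfl
    ext z
    simp [Fin.rev_eq_iff]
  have := h _ _ (hmono f hf) (hmono f' hf') (OrderDual.ofDual y) (OrderDual.ofDual x)
    (OrderDual.ofDual y') (OrderDual.ofDual x')
    (by simp [hy]) (by simp [hx]) (by simp [hy']) (by simp [hx'])
    (by rw [hpre f 0 4 rfl, hpre f' 0 4 rfl]; exact h4)
    (by rw [hpre f 2 2 rfl, hpre f' 2 2 rfl]; exact h2)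
    (by rw [hpre f 4 0 rfl, hpre f' 4 0 rfl]; exact h0)
    (by rw [hpre f 1 3 rfl, hpre f' 1 3 rfl]; exact h3)
    (by rw [hpre f 3 1 rfl, hpre f' 3 1 rfl]; exact h1)
  exact ⟨this.2, this.1⟩

end MSOType

/-! ### Ramsey's theorem. -/

/-- Infinite Ramsey theorem for pairs and finitely many colours. -/
theorem exists_strictMono_monochromatic {T : Type*} [Finite T] (c : ℕ → ℕ → T) :
    ∃ (g : ℕ → ℕ) (t : T), StrictMono g ∧ ∀ i j, i < j → c (g i) (g j) = t := by
  -- A nonprincipal ultrafilter gives each `a` the colour `col a` of almost all pairs `(a, b)`, and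
  -- almost all `a` share one value `t`. Any finite set of such `a` can then be extended by a
  -- further one.
  let U : Ultrafilter ℕ := Filter.hyperfilter ℕ
  have hU : ∀ f : ℕ → T, ∃ t, ∀ᶠ n in U, f n = t := by
    intro f
    have : ∀ᶠ n in U, ∃ t ∈ (Set.univ : Set T), f n = t :=
      Filter.Eventually.of_forall fun n => ⟨f n, trivial, rfl⟩
    obtain ⟨t, -, ht⟩ := (Ultrafilter.eventually_exists_mem_iff Set.finite_univ).1 this
    exact ⟨t, ht⟩
  choose col hcol using fun a => hU (c a)
  obtain ⟨t, ht⟩ := hU col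
  have hgt : ∀ a : ℕ, ∀ᶠ n in U, a < n := fun a =>
    Filter.Eventually.filter_mono (Nat.hyperfilter_le_atTop) (Filter.eventually_gt_atTop a)
  have hstep : ∀ s : Finset ℕ, (∀ a ∈ s, col a = t) →
      ∃ b, col b = t ∧ ∀ a ∈ s, a < b ∧ c a b = t := by
    intro s hs
    have h : ∀ᶠ b in U, ∀ a ∈ s, a < b ∧ c a b = t := by
      rw [Filter.eventually_all_finset]
      intro a ha
      filter_upwards [hgt a, hcol a] with b hb hb'
      exact ⟨hb, hb'.trans (hs a ha)⟩
    exact (ht.and h).exists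
  obtain ⟨g, hg⟩ := exists_seq_of_forall_finset_exists (fun a => col a = t)
    (fun a b => a < b ∧ c a b = t) hstep
  exact ⟨g, t, fun i j hij => (hg.2 i j hij).1, fun i j hij => (hg.2 i j hij).2⟩

/-! ### Largeness, a combinatorial substitute for order type at least `ω ^ k`. -/

/-- `IsOmegaPowLarge r k S` says that the relation `r`, when it is a well-ordering, has order type
at least `ω ^ k` on `S`. -/
def IsOmegaPowLarge {C : Type u} (r : C → C → Prop) : ℕ → Set C → Prop
  | 0, S => S.Nonempty
  | k + 1, S => ∃ E : ℕ → Set C, (∀ i, E i ⊆ S ∧ IsOmegaPowLarge r k (E i)) ∧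
      ∀ i j, i < j → ∀ x ∈ E i, ∀ y ∈ E j, r x y

namespace IsOmegaPowLarge

variable {C : Type u} {r : C → C → Prop} {k : ℕ} {S T : Set C}

theorem mono (h : IsOmegaPowLarge r k S) (hST : S ⊆ T) : IsOmegaPowLarge r k T := by
  cases k with
  | zero => exact Set.Nonempty.mono hST h
  | succ k =>
    obtain ⟨E, hE, hr⟩ := h
    exact ⟨E, fun i => ⟨(hE i).1.trans hST, (hE i).2⟩, hr⟩

theorem of_succ (h : IsOmegaPowLarge r (k + 1) S) : IsOmegaPowLarge r k S := by
  obtain ⟨E, hE, -⟩ := h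
  exact (hE 0).2.mono (hE 0).1

theorem nonempty (h : IsOmegaPowLarge r k S) : S.Nonempty := by
  induction k with
  | zero => exact h
  | succ k ih => exact ih h.of_succ

/-- This is the additive indecomposability of `ω ^ k`. Each `E i` has a large trace on `S` or on
`T`, and one of the two happens along a subsequence. -/
theorem of_union (h : IsOmegaPowLarge r k (S ∪ T)) :
    IsOmegaPowLarge r k S ∨ IsOmegaPowLarge r k T := by
  induction k generalizing S T with
  | zero => exact Set.union_nonempty.1 h
  | succ k ih =>
    obtain ⟨E, hE, hr⟩ := h
    have key : ∀ (S : Set C) (g : ℕ → ℕ), StrictMono g →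
        (∀ n, IsOmegaPowLarge r k (E (g n) ∩ S)) → IsOmegaPowLarge r (k + 1) S :=
      fun S g hg h => ⟨fun n => E (g n) ∩ S, fun n => ⟨Set.inter_subset_right, h n⟩,
        fun i j hij x hx y hy => hr _ _ (hg hij) x hx.1 y hy.1⟩
    have hor : ∀ i, IsOmegaPowLarge r k (E i ∩ S) ∨ IsOmegaPowLarge r k (E i ∩ T) := by
      intro i
      apply ih
      rw [← Set.inter_union_distrib_left, Set.inter_eq_left.2 (hE i).1]
      exact (hE i).2
    by_cases hfin : ∃ N, ∀ i, N ≤ i → IsOmegaPowLarge r k (E i ∩ T)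
    · obtain ⟨N, hN⟩ := hfin
      exact Or.inr (key T (fun n => N + n) (fun a b hab => by simpa using hab)
        fun n => hN _ (Nat.le_add_right _ _))
    · push Not at hfin
      obtain ⟨g, hg, hg'⟩ := Filter.extraction_of_frequently_atTop
        (P := fun i => IsOmegaPowLarge r k (E i ∩ S))
        (Filter.frequently_atTop.2 fun N => by
          obtain ⟨i, hi, hi'⟩ := hfin N
          exact ⟨i, hi, (hor i).resolve_right hi'⟩)
      exact Or.inl (key S g hg hg')

theorem of_biUnion {ι : Type*} {s : Set ι} (hs : s.Finite) {A : ι → Set C}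
    (h : IsOmegaPowLarge r k (⋃ i ∈ s, A i)) : ∃ i ∈ s, IsOmegaPowLarge r k (A i) := by
  induction s, hs using Set.Finite.induction_on with
  | empty =>
    obtain ⟨x, hx⟩ := h.nonempty
    simp at hx
  | @insert a s _ _ ih =>
    rw [Set.biUnion_insert] at h
    rcases h.of_union with h | h
    · exact ⟨a, Set.mem_insert _ _, h⟩
    · obtain ⟨i, hi, hi'⟩ := ih h
      exact ⟨i, Set.mem_insert_of_mem _ hi, hi'⟩

theorem of_iUnion {ι : Type*} [Finite ι] {A : ι → Set C}
    (h : IsOmegaPowLarge r k (⋃ i, A i)) : ∃ i, IsOmegaPowLarge r k (A i) := by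
  have h' : IsOmegaPowLarge r k (⋃ i ∈ (Set.univ : Set ι), A i) := by simpa using h
  obtain ⟨i, -, hi⟩ := of_biUnion Set.finite_univ h'
  exact ⟨i, hi⟩

theorem of_iUnion_of_lt [IsWellOrder C r] {E : ℕ → Set C}
    (hE : ∀ i j, i < j → ∀ x ∈ E i, ∀ y ∈ E j, r x y)
    (h : IsOmegaPowLarge r (k + 1) (⋃ i, E i)) : ∃ i, IsOmegaPowLarge r k (E i) := by
  obtain ⟨F, hF, hr⟩ := h
  obtain ⟨y, hy⟩ := (hF 1).2.nonempty
  obtain ⟨n, hn⟩ := Set.mem_iUnion.1 ((hF 1).1 hy)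
  -- All of `F 0` precedes `y ∈ E n`, so it cannot meet any later `E m`.
  have hsub : F 0 ⊆ ⋃ i ∈ Set.Iic n, E i := by
    intro x hx
    obtain ⟨m, hm⟩ := Set.mem_iUnion.1 ((hF 0).1 hx)
    refine Set.mem_biUnion (x := m) ?_ hm
    by_contra hmn
    exact asymm_of r (hr 0 1 zero_lt_one x hx y hy) (hE n m (not_le.1 hmn) y hn x hm)
  obtain ⟨i, -, hi⟩ := of_biUnion (Set.finite_Iic n) ((hF 0).2.mono hsub)
  exact ⟨i, hi⟩

theorem of_infinite [IsWellOrder C r] (h : S.Infinite) : IsOmegaPowLarge r 1 S := by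
  have := h.to_subtype
  let f : ℕ ↪ S := Infinite.natEmbedding S
  obtain ⟨g, hg | hg⟩ := exists_increasing_or_nonincreasing_subseq r fun n => (f n : C)
  · refine ⟨fun n => {(f (g n) : C)}, fun n => ⟨by simp, by simp [IsOmegaPowLarge]⟩, ?_⟩
    rintro i j hij _ rfl _ rfl
    exact hg i j hij
  · exfalso
    obtain ⟨_, ⟨m, rfl⟩, hm⟩ := (IsWellFounded.wf (r := r)).has_min
      (Set.range fun n => (f (g n) : C)) ⟨_, 0, rfl⟩
    rcases trichotomous_of r (f (g m) : C) (f (g (m + 1))) with h | h | h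
    · exact hg m (m + 1) (Nat.lt_succ_self m) h
    · have := g.injective (f.injective (Subtype.ext h))
      omega
    · exact hm _ ⟨m + 1, rfl⟩ h

theorem infinite [IsWellOrder C r] (h : IsOmegaPowLarge r 1 S) : S.Infinite := by
  obtain ⟨E, hE, hr⟩ := h
  choose x hx using fun i => (hE i).2
  refine Set.infinite_of_injective_forall_mem (f := x) ?_ fun i => (hE i).1 (hx i)
  intro i j hij
  by_contra hne
  rcases lt_or_gt_of_ne hne with h | h
  · exact irrefl_of r (x i) (by simpa [hij] using hr i j h _ (hx i) _ (hx j))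
  · exact irrefl_of r (x i) (by simpa [hij] using hr j i h _ (hx j) _ (hx i))

end IsOmegaPowLarge

/-! ### Largeness of unions of homogeneous sequences. -/

/-- The `i`-th block obtained by joining the members of the sequence `A` between consecutive values
of `g`. -/
def block {C : Type u} (A : ℕ → Set C) (g : ℕ → ℕ) (i : ℕ) : Set C :=
  ⋃ l ∈ Set.Ico (g i) (g (i + 1)), A l

/-- A sequence of sets has homogeneous blocks for the relation `r` if its members can be joined to
form blocks whose elements are finitely coloured so that the relation of the elements of two nonadjacent
blocks is determined by their colours. -/
def HasHomogeneousBlocks {C : Type u} (r : C → C → Prop) (A : ℕ → Set C) : Prop :=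
  ∃ (g : ℕ → ℕ) (T : Type) (_ : Finite T) (σ : ℕ → C → T), StrictMono g ∧
    ∀ i j i' j' x y x' y', i + 1 < j → i' + 1 < j' → x ∈ block A g i → y ∈ block A g j →
      x' ∈ block A g i' → y' ∈ block A g j' → σ i x = σ i' x' → σ j y = σ j' y' →
      (r x y ↔ r x' y')

section Blocks

variable {C : Type u} {r : C → C → Prop} {A : ℕ → Set C}

theorem disjoint_block (hA : Pairwise (Function.onFun Disjoint A)) {g : ℕ → ℕ} (hg : StrictMono g)
    {i j : ℕ} (hij : i < j) {x y : C} (hx : x ∈ block A g i) (hy : y ∈ block A g j) : x ≠ y := by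
  rintro rfl
  obtain ⟨l, hl, hxl⟩ := Set.mem_iUnion₂.1 hx
  obtain ⟨m, hm, hxm⟩ := Set.mem_iUnion₂.1 hy
  have hlm : l < m := hl.2.trans_le ((hg.monotone hij).trans hm.1)
  exact Set.disjoint_left.1 (hA hlm.ne) hxl hxm

/-- In a sequence of nonempty sets that is homogeneous for a well-ordering, the sets follow each
other. -/
theorem rel_of_homogeneous [IsWellOrder C r] {F : ℕ → Set C}
    (hdisj : ∀ i j, i < j → ∀ x ∈ F i, ∀ y ∈ F j, x ≠ y)
    (hF : ∀ i j i' j' x y x' y', i < j → i' < j' → x ∈ F i → y ∈ F j → x' ∈ F i' → y' ∈ F j' →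
      (r x y ↔ r x' y')) :
    (∀ i j, i < j → ∀ x ∈ F i, ∀ y ∈ F j, r x y) ∨ ∃ n, ∀ i, n < i → F i = ∅ := by
  by_cases hall : ∀ i j, i < j → ∀ x ∈ F i, ∀ y ∈ F j, r x y
  · exact Or.inl hall
  · push Not at hall
    obtain ⟨i, j, hij, x, hx, y, hy, hxy⟩ := hall
    right
    obtain ⟨z, hz, hmin⟩ := (IsWellFounded.wf (r := r)).has_min (⋃ i, F i)
      ⟨x, Set.mem_iUnion.2 ⟨i, hx⟩⟩
    obtain ⟨n, hn⟩ := Set.mem_iUnion.1 hz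
    refine ⟨n, fun m hnm => Set.eq_empty_of_forall_notMem fun w hw => ?_⟩
    rcases trichotomous_of r z w with h | h | h
    · exact hxy ((hF i j n m x y z w hij hnm hx hy hn hw).2 h)
    · exact hdisj n m hnm z hn w hw h
    · exact hmin w (Set.mem_iUnion.2 ⟨m, hw⟩) h

/-- Each block has a large colour class, and infinitely many blocks agree on the colour. These
classes form a homogeneous sequence of nonempty sets, which a well-ordering must arrange in
increasing order. -/
theorem HasHomogeneousBlocks.large_iUnion [IsWellOrder C r] (h : HasHomogeneousBlocks r A)
    (hA : Pairwise (Function.onFun Disjoint A)) {k : ℕ} (hk : ∀ i, IsOmegaPowLarge r k (A i)) :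
    IsOmegaPowLarge r (k + 1) (⋃ i, A i) := by
  obtain ⟨g, T, _, σ, hg, hσ⟩ := h
  have hblock : ∀ i, IsOmegaPowLarge r k (block A g i) := fun i =>
    (hk (g i)).mono (Set.subset_biUnion_of_mem (u := A)
      (show g i ∈ Set.Ico (g i) (g (i + 1)) from ⟨le_rfl, hg (Nat.lt_succ_self i)⟩))
  have hcol : ∀ i, ∃ t, IsOmegaPowLarge r k {x ∈ block A g i | σ i x = t} := fun i =>
    IsOmegaPowLarge.of_iUnion ((hblock i).mono fun x hx => Set.mem_iUnion.2 ⟨σ i x, hx, rfl⟩)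
  choose col hcol using hcol
  obtain ⟨e, t, he, ht⟩ := exists_strictMono_monochromatic fun i _ => col (2 * i)
  have ht : ∀ i, col (2 * e i) = t := fun i => ht i (i + 1) (Nat.lt_succ_self i)
  -- Even indices keep the chosen blocks nonadjacent, as homogeneity requires.
  let F : ℕ → Set C := fun i => {x ∈ block A g (2 * e i) | σ (2 * e i) x = t}
  have hFlarge : ∀ i, IsOmegaPowLarge r k (F i) := fun i => by
    have := hcol (2 * e i)
    rwa [ht i] at this
  have hlt : ∀ {i j}, i < j → 2 * e i + 1 < 2 * e j := fun hij => by
    have := he hij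
    omega
  rcases rel_of_homogeneous (r := r) (F := F)
    (fun i j hij x hx y hy => disjoint_block hA hg (by have := hlt hij; omega) hx.1 hy.1)
    (fun i j i' j' x y x' y' hij hij' hx hy hx' hy' =>
      hσ _ _ _ _ x y x' y' (hlt hij) (hlt hij') hx.1 hy.1 hx'.1 hy'.1
        (hx.2.trans hx'.2.symm) (hy.2.trans hy'.2.symm)) with hrel | ⟨n, hn⟩
  · refine ⟨F, fun i => ⟨fun x hx => ?_, hFlarge i⟩, hrel⟩
    obtain ⟨l, -, hl⟩ := Set.mem_iUnion₂.1 hx.1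
    exact Set.mem_iUnion.2 ⟨l, hl⟩
  · exact absurd (hn (n + 1) (Nat.lt_succ_self n)) (hFlarge (n + 1)).nonempty.ne_empty

/-- Splitting by colour and by parity of the block index covers all but the first `g 0` sets by
finitely many homogeneous sequences. The large one either increases, so that `of_iUnion_of_lt`
applies, or has only finitely many nonempty terms. -/
theorem HasHomogeneousBlocks.exists_large [IsWellOrder C r] (h : HasHomogeneousBlocks r A)
    (hA : Pairwise (Function.onFun Disjoint A)) {k : ℕ}
    (hk : IsOmegaPowLarge r (k + 1) (⋃ i, A i)) : ∃ i, IsOmegaPowLarge r k (A i) := by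
  obtain ⟨g, T, _, σ, hg, hσ⟩ := h
  have hbl : ∀ i, IsOmegaPowLarge r k (block A g i) → ∃ i, IsOmegaPowLarge r k (A i) := fun i hi =>
    (IsOmegaPowLarge.of_biUnion (Set.finite_Ico _ _) hi).imp fun _ h => h.2
  let F : T × Fin 2 → ℕ → Set C := fun p i => {x ∈ block A g (2 * i + p.2) |
    σ (2 * i + p.2) x = p.1}
  have hcover : ⋃ i, A i ⊆ (⋃ i ∈ Set.Iio (g 0), A i) ∪ ⋃ p, ⋃ i, F p i := by
    intro x hx
    obtain ⟨l, hl⟩ := Set.mem_iUnion.1 hx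
    rcases lt_or_ge l (g 0) with hlt | hge
    · exact Or.inl (Set.mem_biUnion hlt hl)
    · right
      have hex : ∃ n, l < g (n + 1) := ⟨l, (Nat.lt_succ_self l).trans_le (hg.id_le _)⟩
      classical
      have hfind := Nat.find_spec hex
      set m := Nat.find hex with hm
      have hle : g m ≤ l := by
        cases hm' : m with
        | zero => exact hge
        | succ m' =>
          exact not_lt.1 (Nat.find_min hex (m := m') (by omega))
      refine Set.mem_iUnion.2 ⟨(σ m x, ⟨m % 2, Nat.mod_lt _ two_pos⟩),
        Set.mem_iUnion.2 ⟨m / 2, ?_⟩⟩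
      have : 2 * (m / 2) + m % 2 = m := Nat.div_add_mod m 2
      change x ∈ block A g (2 * (m / 2) + m % 2) ∧ σ (2 * (m / 2) + m % 2) x = σ m x
      rw [this]
      exact ⟨Set.mem_biUnion (x := l) ⟨hle, hfind⟩ hl, rfl⟩
  rcases (hk.mono hcover).of_union with h | h
  · exact (IsOmegaPowLarge.of_biUnion (Set.finite_Iio _) h.of_succ).imp fun _ h => h.2
  · obtain ⟨⟨t, p⟩, hp⟩ := h.of_iUnion
    have hsub : ∀ i, F (t, p) i ⊆ block A g (2 * i + p) := fun i x hx => hx.1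
    rcases rel_of_homogeneous (r := r) (F := F (t, p))
      (fun i j hij x hx y hy => disjoint_block hA hg (by omega) hx.1 hy.1)
      (fun i j i' j' x y x' y' hij hij' hx hy hx' hy' =>
        hσ _ _ _ _ x y x' y' (by omega) (by omega) hx.1 hy.1 hx'.1 hy'.1
          (hx.2.trans hx'.2.symm) (hy.2.trans hy'.2.symm)) with hrel | ⟨n, hn⟩
    · obtain ⟨i, hi⟩ := IsOmegaPowLarge.of_iUnion_of_lt hrel hp
      exact hbl _ (hi.mono (hsub i))
    · have hfin : (⋃ i, F (t, p) i) ⊆ ⋃ i ∈ Set.Iic n, F (t, p) i := by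
        intro x hx
        obtain ⟨i, hi⟩ := Set.mem_iUnion.1 hx
        refine Set.mem_biUnion (x := i) ?_ hi
        by_contra hni
        rw [hn i (not_le.1 hni)] at hi
        exact hi
      obtain ⟨i, -, hi⟩ := IsOmegaPowLarge.of_biUnion (Set.finite_Iic n) (hp.of_succ.mono hfin)
      exact hbl _ (hi.mono (hsub i))

end Blocks

section OrderFree

variable {C : Type u} {r : C → C → Prop}

theorem IsOmegaPowLarge.dual {k : ℕ} {S : Set C} (h : IsOmegaPowLarge r k S) :
    IsOmegaPowLarge (C := Cᵒᵈ) (fun x y => r (OrderDual.ofDual x) (OrderDual.ofDual y)) k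
      (OrderDual.ofDual ⁻¹' S) := h

theorem IsOmegaPowLarge.of_dual {k : ℕ} {S : Set Cᵒᵈ}
    (h : IsOmegaPowLarge (C := Cᵒᵈ) (fun x y => r (OrderDual.ofDual x) (OrderDual.ofDual y)) k S) :
    IsOmegaPowLarge r k (OrderDual.toDual ⁻¹' S) := h

theorem isWellOrder_dual (r : C → C → Prop) [h : IsWellOrder C r] :
    IsWellOrder Cᵒᵈ (fun x y => r (OrderDual.ofDual x) (OrderDual.ofDual y)) := h

theorem IsOmegaPowLarge.infinite_of_pos [IsWellOrder C r] {k : ℕ} (hk : 1 ≤ k) {S : Set C}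
    (h : IsOmegaPowLarge r k S) : S.Infinite := by
  induction k, hk using Nat.le_induction with
  | base => exact h.infinite
  | succ k _ ih => exact ih h.of_succ

theorem IsOmegaPowLarge.sdiff_finite [IsWellOrder C r] {k : ℕ} (hk : 1 ≤ k) {S T : Set C}
    (h : IsOmegaPowLarge r k (S ∪ T)) (hT : T.Finite) : IsOmegaPowLarge r k S :=
  h.of_union.resolve_right fun h => h.infinite_of_pos hk hT

end OrderFree

section Chains

/-! ### Largeness of convex sets is independent of the well-ordering. -/

variable {C : Type u} [LinearOrder C] {r s : C → C → Prop}

/-- Cutting a chain at four points. -/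
noncomputable def cutAt (p₁ p₂ p₃ p₄ z : C) : Fin 5 :=
  if z < p₁ then 0 else if z < p₂ then 1 else if z < p₃ then 2 else if z < p₄ then 3 else 4

theorem monotone_cutAt {p₁ p₂ p₃ p₄ : C} (h₁ : p₁ ≤ p₂) (h₂ : p₂ ≤ p₃) (h₃ : p₃ ≤ p₄) :
    Monotone (cutAt p₁ p₂ p₃ p₄) := by
  intro a b hab
  unfold cutAt
  split_ifs <;> first | decide | (exfalso; order)

theorem cutAt_preimage {p₁ p₂ p₃ p₄ : C} (h₁ : p₁ ≤ p₂) (h₂ : p₂ ≤ p₃) (h₃ : p₃ ≤ p₄) :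
    cutAt p₁ p₂ p₃ p₄ ⁻¹' {0} = Set.Iio p₁ ∧ cutAt p₁ p₂ p₃ p₄ ⁻¹' {1} = Set.Ico p₁ p₂ ∧
    cutAt p₁ p₂ p₃ p₄ ⁻¹' {2} = Set.Ico p₂ p₃ ∧ cutAt p₁ p₂ p₃ p₄ ⁻¹' {3} = Set.Ico p₃ p₄ ∧
    cutAt p₁ p₂ p₃ p₄ ⁻¹' {4} = Set.Ici p₄ := by
  refine ⟨?_, ?_, ?_, ?_, ?_⟩ <;> ext z <;>
    simp only [cutAt, Set.mem_preimage, Set.mem_singleton_iff, Set.mem_Iio, Set.mem_Ico,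
      Set.mem_Ici] <;>
    split_ifs <;> simp <;> first | order | (constructor <;> order)

theorem block_Ico_subset {c : ℕ → C} (hc : Monotone c) {g : ℕ → ℕ} (i : ℕ) :
    block (fun l => Set.Ico (c l) (c (l + 1))) g i ⊆ Set.Ico (c (g i)) (c (g (i + 1))) := by
  intro x hx
  obtain ⟨l, hl, hx⟩ := Set.mem_iUnion₂.1 hx
  exact ⟨(hc hl.1).trans hx.1, hx.2.trans_le (hc hl.2)⟩

theorem PiecewiseDetermined.hasHomogeneousBlocks (hr : PiecewiseDetermined r) {c : ℕ → C}
    (hc : Monotone c) : HasHomogeneousBlocks r fun i => Set.Ico (c i) (c (i + 1)) := by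
  obtain ⟨T, _, τ, σ, h⟩ := hr
  -- Homogenizing the two outer segments and the middle one leaves only the colours `σ` of the two
  -- marked blocks to vary.
  obtain ⟨g, t, hg, ht⟩ := exists_strictMono_monochromatic fun a b =>
    (τ (Set.Iio (c a)), τ (Set.Ico (c a) (c b)), τ (Set.Ici (c b)))
  refine ⟨g, T, inferInstance, fun i => σ (Set.Ico (c (g i)) (c (g (i + 1)))), hg, ?_⟩
  intro i j i' j' x y x' y' hij hij' hx hy hx' hy' hσx hσy
  have hle : ∀ {a b}, a ≤ b → c (g a) ≤ c (g b) := fun hab => hc (hg.monotone hab)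
  have e₁ := cutAt_preimage (hle (Nat.le_succ i)) (hle hij.le) (hle (Nat.le_succ j))
  have e₂ := cutAt_preimage (hle (Nat.le_succ i')) (hle hij'.le) (hle (Nat.le_succ j'))
  have ht' : ∀ {a b a' b'}, a < b → a' < b' → _ := fun {a b a' b'} hab hab' =>
    (ht a b hab).trans (ht a' b' hab').symm
  simp only [Prod.mk.injEq] at ht'
  refine (h _ _ (monotone_cutAt (hle (Nat.le_succ i)) (hle hij.le) (hle (Nat.le_succ j)))
    (monotone_cutAt (hle (Nat.le_succ i')) (hle hij'.le) (hle (Nat.le_succ j')))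
    x y x' y' ?_ ?_ ?_ ?_ ?_ ?_ ?_ ?_ ?_).1
  · exact e₁.2.1.ge (block_Ico_subset hc i hx)
  · exact e₁.2.2.2.1.ge (block_Ico_subset hc j hy)
  · exact e₂.2.1.ge (block_Ico_subset hc i' hx')
  · exact e₂.2.2.2.1.ge (block_Ico_subset hc j' hy')
  · rw [e₁.1, e₂.1]
    exact (ht' (Nat.lt_succ_self i) (Nat.lt_succ_self i')).1
  · rw [e₁.2.2.1, e₂.2.2.1]
    exact (ht' hij hij').2.1
  · rw [e₁.2.2.2.2, e₂.2.2.2.2]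
    exact (ht' (Nat.lt_succ_self j) (Nat.lt_succ_self j')).2.2
  · rw [e₁.2.1, e₂.2.1]
    exact hσx
  · rw [e₁.2.2.2.1, e₂.2.2.2.1]
    exact hσy

theorem PiecewiseDetermined.large_iUnion_Ico [IsWellOrder C r] (hr : PiecewiseDetermined r)
    {c : ℕ → C} (hc : Monotone c) {k : ℕ}
    (hk : ∀ i, IsOmegaPowLarge r k (Set.Ico (c i) (c (i + 1)))) :
    IsOmegaPowLarge r (k + 1) (⋃ i, Set.Ico (c i) (c (i + 1))) :=
  (hr.hasHomogeneousBlocks hc).large_iUnion hc.pairwise_disjoint_on_Ico_succ hk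

theorem PiecewiseDetermined.exists_large_Ico [IsWellOrder C r] (hr : PiecewiseDetermined r)
    {c : ℕ → C} (hc : Monotone c) {k : ℕ}
    (hk : IsOmegaPowLarge r (k + 1) (⋃ i, Set.Ico (c i) (c (i + 1)))) :
    ∃ i, IsOmegaPowLarge r k (Set.Ico (c i) (c (i + 1))) :=
  (hr.hasHomogeneousBlocks hc).exists_large hc.pairwise_disjoint_on_Ico_succ hk

theorem PiecewiseDetermined.large_of_strictMono [IsWellOrder C r] (hr : PiecewiseDetermined r)
    {c : ℕ → C} (hc : StrictMono c) {k : ℕ} (hk : 1 ≤ k)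
    (h : ∀ i, IsOmegaPowLarge r k (Set.uIcc (c i) (c (i + 1)))) {S : Set C} (hS : S.OrdConnected)
    (hcS : ∀ i, c i ∈ S) : IsOmegaPowLarge r (k + 1) S := by
  refine (hr.large_iUnion_Ico hc.monotone fun i => ?_).mono
    (Set.iUnion_subset fun i => Set.Ico_subset_Icc_self.trans (hS.out (hcS i) (hcS (i + 1))))
  -- Closed intervals become half-open ones at the cost of one point, harmless since `1 ≤ k`.
  have := h i
  rw [Set.uIcc_of_le (hc (Nat.lt_succ_self i)).le,
    ← Set.Ico_union_right (hc (Nat.lt_succ_self i)).le] at this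
  exact this.sdiff_finite hk (Set.finite_singleton _)

/-- Countability supplies a sequence `c` cofinal in `E`. Up to at most one point, the maximum of
`E`, the interval from `a` to `c 0` and the steps of `c` cover `E`, so one of these intervals is
large. -/
theorem PiecewiseDetermined.exists_large_uIcc_of_subset_Ici [Countable C] [IsWellOrder C r]
    (hr : PiecewiseDetermined r) {k : ℕ} {E : Set C} {a : C} (ha : a ∈ E)
    (hE : ∀ x ∈ E, a ≤ x) (h : IsOmegaPowLarge r (k + 1) E) :
    ∃ x ∈ E, ∃ y ∈ E, IsOmegaPowLarge r k (Set.uIcc x y) := by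
  have : Nonempty E := ⟨⟨a, ha⟩⟩
  obtain ⟨c, hc, hlim⟩ := Filter.exists_seq_monotone_tendsto_atTop_atTop E
  have hc' : Monotone fun n => (c n : C) := hc
  have hcover : E ⊆ (Set.uIcc a (c 0) ∪ ⋃ n, Set.Ico (c n : C) (c (n + 1))) ∪
      {y | y ∈ E ∧ ∀ n, (c n : C) ≤ y} := by
    intro y hy
    by_cases hall : ∀ n, (c n : C) ≤ y
    · exact Or.inr ⟨hy, hall⟩
    · left
      push Not at hall
      classical
      have hfind := Nat.find_spec hall
      cases hm : Nat.find hall with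
      | zero =>
        rw [hm] at hfind
        left
        rw [Set.uIcc_of_le (hE _ (c 0).2)]
        exact ⟨hE y hy, hfind.le⟩
      | succ m =>
        rw [hm] at hfind
        exact Or.inr (Set.mem_iUnion.2
          ⟨m, not_lt.1 (Nat.find_min hall (m := m) (by omega)), hfind⟩)
  have hfin : {y | y ∈ E ∧ ∀ n, (c n : C) ≤ y}.Finite := by
    have hmax : ∀ y ∈ {y | y ∈ E ∧ ∀ n, (c n : C) ≤ y}, ∀ z ∈ E, z ≤ y := by
      intro y hy z hz
      obtain ⟨n, hn⟩ := (hlim.eventually_ge_atTop ⟨z, hz⟩).exists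
      exact (show z ≤ c n from hn).trans (hy.2 n)
    exact Set.Subsingleton.finite fun y hy z hz => le_antisymm (hmax z hz y hy.1) (hmax y hy z hz.1)
  rcases ((h.mono hcover).sdiff_finite (Nat.le_add_left 1 k) hfin).of_union with h | h
  · exact ⟨a, ha, c 0, (c 0).2, h.of_succ⟩
  · obtain ⟨n, hn⟩ := hr.exists_large_Ico hc' h
    refine ⟨c n, (c n).2, c (n + 1), (c (n + 1)).2, hn.mono ?_⟩
    exact Set.Ico_subset_Icc_self.trans Set.Icc_subset_uIcc

theorem PiecewiseDetermined.large_of_strictAnti [IsWellOrder C r] (hr : PiecewiseDetermined r)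
    {c : ℕ → C} (hc : StrictAnti c) {k : ℕ} (hk : 1 ≤ k)
    (h : ∀ i, IsOmegaPowLarge r k (Set.uIcc (c i) (c (i + 1)))) {S : Set C} (hS : S.OrdConnected)
    (hcS : ∀ i, c i ∈ S) : IsOmegaPowLarge r (k + 1) S := by
  have := isWellOrder_dual r
  refine (hr.dual.large_of_strictMono (c := fun i => OrderDual.toDual (c i)) hc.dual_right hk
    (fun i => ?_) hS.dual hcS).of_dual
  rw [Set.uIcc_toDual]
  exact (h i).dual

theorem PiecewiseDetermined.exists_large_uIcc_of_subset_Iic [Countable C] [IsWellOrder C r]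
    (hr : PiecewiseDetermined r) {k : ℕ} {E : Set C} {a : C} (ha : a ∈ E)
    (hE : ∀ x ∈ E, x ≤ a) (h : IsOmegaPowLarge r (k + 1) E) :
    ∃ x ∈ E, ∃ y ∈ E, IsOmegaPowLarge r k (Set.uIcc x y) := by
  have := isWellOrder_dual r
  have : Countable Cᵒᵈ := inferInstanceAs (Countable C)
  obtain ⟨x, hx, y, hy, hxy⟩ := hr.dual.exists_large_uIcc_of_subset_Ici
    (E := OrderDual.ofDual ⁻¹' E) (a := OrderDual.toDual a) ha (fun x hx => hE _ hx) h.dual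
  refine ⟨OrderDual.ofDual x, hx, OrderDual.ofDual y, hy, ?_⟩
  rw [← OrderDual.toDual_ofDual x, ← OrderDual.toDual_ofDual y, Set.uIcc_toDual] at hxy
  exact hxy.of_dual

/-- Two points are equivalent if the interval between them is not large. -/
def notLargeSetoid (r : C → C → Prop) [IsWellOrder C r] {k : ℕ} (hk : 1 ≤ k) : Setoid C where
  r x y := ¬ IsOmegaPowLarge r k (Set.uIcc x y)
  iseqv :=
    -- Reflexivity needs `1 ≤ k`: a singleton is `0`-large.
    { refl := fun x h => h.infinite_of_pos hk (by simp)
      symm := fun {x y} h => by rwa [Set.uIcc_comm]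
      trans := fun {x y z} h₁ h₂ h =>
        (h.mono Set.uIcc_subset_uIcc_union_uIcc).of_union.elim h₁ h₂ }

/-- Infinitely many classes would yield a strictly monotone or antitone sequence in `S` with large
intervals between consecutive terms, making `S` large one level up. -/
theorem PiecewiseDetermined.finite_image_quotient [IsWellOrder C r] (hr : PiecewiseDetermined r)
    {k : ℕ} (hk : 1 ≤ k) {S : Set C} (hS : S.OrdConnected) (h : ¬ IsOmegaPowLarge r (k + 1) S) :
    ((Quotient.mk (notLargeSetoid r hk)) '' S).Finite := by
  by_contra hinf
  have := Set.Infinite.to_subtype hinf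
  let q := Infinite.natEmbedding (Quotient.mk (notLargeSetoid r hk) '' S)
  choose x hxS hxq using fun n => (q n).2
  have hlarge : ∀ m n, m ≠ n → IsOmegaPowLarge r k (Set.uIcc (x m) (x n)) := by
    intro m n hmn
    by_contra hsmall
    refine hmn (q.injective (Subtype.ext ?_))
    rw [← hxq m, ← hxq n]
    exact Quotient.sound hsmall
  have hx : ∀ m n, m ≠ n → x m ≠ x n := fun m n hmn heq =>
    (hlarge m n hmn).infinite_of_pos hk (by simp [heq])
  obtain ⟨g, hg | hg⟩ := exists_increasing_or_nonincreasing_subseq (· < ·) x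
  · exact h (hr.large_of_strictMono (c := fun n => x (g n)) (fun m n hmn => hg m n hmn) hk
      (fun i => hlarge _ _ (g.injective.ne (Nat.lt_succ_self i).ne)) hS fun i => hxS _)
  · exact h (hr.large_of_strictAnti (c := fun n => x (g n))
      (fun m n hmn => lt_of_le_of_ne (not_lt.1 (hg m n hmn)) (hx _ _ (g.injective.ne hmn.ne'))) hk
      (fun i => hlarge _ _ (g.injective.ne (Nat.lt_succ_self i).ne)) hS fun i => hxS _)

/-- In a countable chain, all piecewise determined well-orderings make the same convex sets
large. -/
theorem PiecewiseDetermined.large_of_large [Countable C] [IsWellOrder C r] [IsWellOrder C s]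
    (hr : PiecewiseDetermined r) (hs : PiecewiseDetermined s) {k : ℕ} (hk : 1 ≤ k) {S : Set C}
    (hS : S.OrdConnected) (h : IsOmegaPowLarge s k S) : IsOmegaPowLarge r k S := by
  induction k, hk using Nat.le_induction generalizing S with
  -- For `k = 1` largeness is infinitude, which mentions no ordering.
  | base => exact IsOmegaPowLarge.of_infinite h.infinite
  | succ k hk ih =>
    by_contra hsmall
    have hfin := hr.finite_image_quotient hk hS hsmall
    have hcover : S ⊆ ⋃ q ∈ Quotient.mk (notLargeSetoid r hk) '' S,
        {x | Quotient.mk (notLargeSetoid r hk) x = q} :=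
      fun x hx => Set.mem_biUnion (Set.mem_image_of_mem _ hx) rfl
    obtain ⟨q, ⟨a, haS, rfl⟩, hq⟩ := IsOmegaPowLarge.of_biUnion hfin (h.mono hcover)
    have hclass : ∀ x y, Quotient.mk (notLargeSetoid r hk) x = Quotient.mk _ a →
        Quotient.mk (notLargeSetoid r hk) y = Quotient.mk _ a →
        ¬ IsOmegaPowLarge s k (Set.uIcc x y) := fun x y hx hy hxy =>
      Quotient.exact (hx.trans hy.symm) (ih Set.ordConnected_uIcc hxy)
    have hsplit : {x | Quotient.mk (notLargeSetoid r hk) x = Quotient.mk _ a} ⊆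
        {x | Quotient.mk (notLargeSetoid r hk) x = Quotient.mk _ a ∧ a ≤ x} ∪
        {x | Quotient.mk (notLargeSetoid r hk) x = Quotient.mk _ a ∧ x ≤ a} :=
      fun x hx => (le_total a x).imp (fun h => ⟨hx, h⟩) fun h => ⟨hx, h⟩
    rcases (hq.mono hsplit).of_union with h | h
    · obtain ⟨x, hx, y, hy, hxy⟩ := hs.exists_large_uIcc_of_subset_Ici
        (E := {x | Quotient.mk (notLargeSetoid r hk) x = Quotient.mk _ a ∧ a ≤ x})
        (a := a) ⟨rfl, le_rfl⟩ (fun x hx => hx.2) h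
      exact hclass x y hx.1 hy.1 hxy
    · obtain ⟨x, hx, y, hy, hxy⟩ := hs.exists_large_uIcc_of_subset_Iic
        (E := {x | Quotient.mk (notLargeSetoid r hk) x = Quotient.mk _ a ∧ x ≤ a})
        (a := a) ⟨rfl, le_rfl⟩ (fun x hx => hx.2) h
      exact hclass x y hx.1 hy.1 hxy

end Chains

/-! ### Largeness and ordinals. -/

section OrderType

variable {C : Type u} {r : C → C → Prop} [IsWellOrder C r]

/-- The bounds `a` and `b` are carried along so that the induction applies to each `E i`, whose
positions start no earlier than `a + ω ^ k * i`. -/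
theorem IsOmegaPowLarge.add_opow_le {k : ℕ} {S : Set C} (h : IsOmegaPowLarge r k S)
    {a b : Ordinal.{u}} (ha : ∀ x ∈ S, a ≤ Ordinal.typein r x)
    (hb : ∀ x ∈ S, Ordinal.typein r x < b) :
    a + Ordinal.omega0 ^ (k : Ordinal.{u}) ≤ b := by
  induction k generalizing S a b with
  | zero =>
    obtain ⟨x, hx⟩ := h
    simpa using Order.succ_le_of_lt ((ha x hx).trans_lt (hb x hx))
  | succ k ih =>
    obtain ⟨E, hE, hr⟩ := h
    have hlow : ∀ i : ℕ, ∀ x ∈ E i,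
        a + Ordinal.omega0 ^ (k : Ordinal.{u}) * i ≤ Ordinal.typein r x := by
      intro i
      induction i with
      | zero => intro x hx; simpa using ha x ((hE 0).1 hx)
      | succ i ihi =>
        intro x hx
        have := ih (hE i).2 ihi fun y hy =>
          (Ordinal.typein_lt_typein r).2 (hr i (i + 1) (Nat.lt_succ_self i) y hy x hx)
        rwa [Nat.cast_succ, mul_add_one, ← add_assoc]
    have hlim : a + Ordinal.omega0 ^ (k : Ordinal.{u}) * Ordinal.omega0 ≤ b := by
      rw [Ordinal.add_le_iff_of_isSuccLimit (Ordinal.isSuccLimit_mul_right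
        (Ordinal.opow_pos _ Ordinal.omega0_pos) Ordinal.isSuccLimit_omega0)]
      intro d hd
      obtain ⟨c, hc, hdc⟩ := (Ordinal.lt_mul_iff_of_isSuccLimit Ordinal.isSuccLimit_omega0).1 hd
      obtain ⟨i, rfl⟩ := Ordinal.lt_omega0.1 hc
      obtain ⟨x, hx⟩ := (hE i).2.nonempty
      calc a + d ≤ a + Ordinal.omega0 ^ (k : Ordinal.{u}) * i := by gcongr
        _ ≤ Ordinal.typein r x := hlow i x hx
        _ ≤ b := (hb x ((hE i).1 hx)).le
    rwa [Nat.cast_succ, Ordinal.opow_add, Ordinal.opow_one]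

theorem isOmegaPowLarge_of_add_opow_le {k : ℕ} {a : Ordinal.{u}}
    (h : a + Ordinal.omega0 ^ (k : Ordinal.{u}) ≤ Ordinal.type r) :
    IsOmegaPowLarge r k {x | a ≤ Ordinal.typein r x ∧
      Ordinal.typein r x < a + Ordinal.omega0 ^ (k : Ordinal.{u})} := by
  induction k generalizing a with
  | zero =>
    have h1 : a < a + Ordinal.omega0 ^ ((0 : ℕ) : Ordinal.{u}) := by simp
    obtain ⟨x, rfl⟩ := Ordinal.typein_surj r (h1.trans_le h)
    exact ⟨x, le_rfl, h1⟩
  | succ k ih =>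
    have hsucc : Ordinal.omega0 ^ ((k + 1 : ℕ) : Ordinal.{u}) =
        Ordinal.omega0 ^ (k : Ordinal.{u}) * Ordinal.omega0 := by
      rw [Nat.cast_succ, Ordinal.opow_add, Ordinal.opow_one]
    have hle : ∀ i : ℕ, a + Ordinal.omega0 ^ (k : Ordinal.{u}) * i +
        Ordinal.omega0 ^ (k : Ordinal.{u}) ≤ a + Ordinal.omega0 ^ ((k + 1 : ℕ) : Ordinal.{u}) := by
      intro i
      rw [hsucc, add_assoc, ← mul_add_one, ← Nat.cast_succ]
      gcongr
      exact (Ordinal.natCast_lt_omega0 _).le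
    refine ⟨fun i => {x | a + Ordinal.omega0 ^ (k : Ordinal.{u}) * i ≤ Ordinal.typein r x ∧
      Ordinal.typein r x < a + Ordinal.omega0 ^ (k : Ordinal.{u}) * i +
        Ordinal.omega0 ^ (k : Ordinal.{u})},
      fun i => ⟨fun x hx => ⟨le_self_add.trans hx.1, hx.2.trans_le (hle i)⟩,
        ih ((hle i).trans h)⟩, ?_⟩
    intro i j hij x hx y hy
    refine (Ordinal.typein_lt_typein r).1 (hx.2.trans_le (le_trans ?_ hy.1))
    rw [add_assoc, ← mul_add_one, ← Nat.cast_succ]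
    gcongr
    exact hij

theorem isOmegaPowLarge_univ_iff {k : ℕ} :
    IsOmegaPowLarge r k Set.univ ↔ Ordinal.omega0 ^ (k : Ordinal.{u}) ≤ Ordinal.type r := by
  constructor
  · intro h
    simpa using h.add_opow_le (a := 0) (b := Ordinal.type r) (fun _ _ => zero_le)
      fun x _ => Ordinal.typein_lt_type r x
  · intro h
    exact (isOmegaPowLarge_of_add_opow_le (a := 0) (by simpa using h)).mono (Set.subset_univ _)

theorem not_type_lt_opow_zero [Nonempty C] :
    ¬ Ordinal.type r < Ordinal.omega0 ^ ((0 : ℕ) : Ordinal.{u}) := by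
  rw [not_lt, ← isOmegaPowLarge_univ_iff]
  exact Set.univ_nonempty

theorem countable_of_type_lt_opow {k : ℕ}
    (h : Ordinal.type r < Ordinal.omega0 ^ (k : Ordinal.{u})) : Countable C := by
  rw [← Cardinal.mk_le_aleph0_iff, ← Ordinal.card_type r]
  refine (Ordinal.card_le_card h.le).trans ((Ordinal.card_opow_le _ _).trans ?_)
  simp

end OrderType

theorem HasDefinableWellOrderOfType.lt_opow_of_lt_opow {C : Type u} [LinearOrder C] [Nonempty C]
    {o o' : Ordinal.{u}} (ho : HasDefinableWellOrderOfType C o)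
    (ho' : HasDefinableWellOrderOfType C o') {k : ℕ}
    (h : o < Ordinal.omega0 ^ (k : Ordinal.{u})) : o' < Ordinal.omega0 ^ (k : Ordinal.{u}) := by
  obtain ⟨r, _, hr, rfl⟩ := ho
  obtain ⟨s, _, hs, rfl⟩ := ho'
  have := countable_of_type_lt_opow h
  rcases Nat.eq_zero_or_pos k with rfl | hk
  · exact absurd h not_type_lt_opow_zero
  · rw [← not_le, ← isOmegaPowLarge_univ_iff] at h ⊢
    exact fun h' => h (hr.piecewiseDetermined.large_of_large hs.piecewiseDetermined hk
      Set.ordConnected_univ h')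

/-! ### Existence of a definable well-ordering. -/

section Existence

/-- The iterated lexicographic relation given by `n` levels of blocks: two points lie in the same
block of level `k` if `P k` is constant on the interval between them, and `D k` tells whether blocks
of level `k` are compared according to the chain or in the opposite way. -/
def lexRel {C : Type u} [LinearOrder C] (P D : ℕ → Set C) : ℕ → C → C → Prop
  | 0, x, y => x < y
  | n + 1, x, y =>
    (∀ z ∈ Set.uIcc x y, z ∈ P n ↔ x ∈ P n) ∧ lexRel P D n x y ∨
      ¬ (∀ z ∈ Set.uIcc x y, z ∈ P n ↔ x ∈ P n) ∧ (x ∈ D n ∧ x < y ∨ x ∉ D n ∧ y < x)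

/-- A relation defined by a formula with the fixed tuple `Q` of parameters. -/
def DefinableWith {C : Type u} [LinearOrder C] {m : ℕ} (Q : Fin m → Set C)
    (R : C → C → Prop) : Prop :=
  ∃ φ : MSOFormula 2 m, ∀ x y : C, φ.Sat ![x, y] Q ↔ R x y

namespace DefinableWith

variable {C : Type u} [LinearOrder C] {m : ℕ} {Q : Fin m → Set C} {R R' : C → C → Prop}

theorem not (h : DefinableWith Q R) : DefinableWith Q fun x y => ¬ R x y := by
  obtain ⟨φ, hφ⟩ := h
  exact ⟨.neg φ, fun x y => not_congr (hφ x y)⟩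

theorem and (h : DefinableWith Q R) (h' : DefinableWith Q R') :
    DefinableWith Q fun x y => R x y ∧ R' x y := by
  obtain ⟨φ, hφ⟩ := h
  obtain ⟨ψ, hψ⟩ := h'
  exact ⟨.and φ ψ, fun x y => and_congr (hφ x y) (hψ x y)⟩

theorem or (h : DefinableWith Q R) (h' : DefinableWith Q R') :
    DefinableWith Q fun x y => R x y ∨ R' x y := by
  have := (h.not.and h'.not).not
  simpa only [not_and_or, not_not] using this

theorem lt : DefinableWith Q fun x y => x < y := ⟨.lt 0 1, fun _ _ => Iff.rfl⟩

theorem gt : DefinableWith Q fun x y => y < x := ⟨.lt 1 0, fun _ _ => Iff.rfl⟩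

theorem mem (j : Fin m) : DefinableWith Q fun x _ => x ∈ Q j := ⟨.mem 0 j, fun _ _ => Iff.rfl⟩

theorem forall_mem_uIcc (j : Fin m) :
    DefinableWith Q fun x y => ∀ z ∈ Set.uIcc x y, z ∈ Q j ↔ x ∈ Q j := by
  let below : Fin 3 → MSOFormula 3 m := fun i => .and (.neg (.lt 0 1)) (.neg (.lt 0 2))
  let out : MSOFormula 3 m :=
    -- Variable `0` is the bound `z`, and `1`, `2` are `x`, `y`. Being neither below both nor above
    -- both means lying in `Set.uIcc x y`.
    .and (.neg (.and (.lt 0 1) (.lt 0 2))) (.neg (.and (.lt 1 0) (.lt 2 0)))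
  let diff : MSOFormula 3 m :=
    .and (.neg (.and (.mem 0 j) (.mem 1 j))) (.neg (.and (.neg (.mem 0 j)) (.neg (.mem 1 j))))
  refine ⟨.neg (.exElem (.and out diff)), fun x y => ?_⟩
  change (¬ ∃ z, (¬ (z < x ∧ z < y) ∧ ¬ (x < z ∧ y < z)) ∧
    (¬ (z ∈ Q j ∧ x ∈ Q j) ∧ ¬ (¬ z ∈ Q j ∧ ¬ x ∈ Q j))) ↔ _
  have hmem : ∀ z, (¬ (z < x ∧ z < y) ∧ ¬ (x < z ∧ y < z)) ↔ z ∈ Set.uIcc x y := by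
    intro z
    simp only [Set.uIcc, Set.mem_Icc, inf_le_iff, le_sup_iff, not_and_or, not_lt]
  simp only [hmem, not_exists]
  refine forall_congr' fun z => ?_
  tauto

theorem lexRel {P D : ℕ → Set C} {n : ℕ} (hP : ∀ k < n, ∃ j, Q j = P k)
    (hD : ∀ k < n, ∃ j, Q j = D k) : DefinableWith Q (lexRel P D n) := by
  induction n with
  | zero => exact lt
  | succ n ih =>
    obtain ⟨p, hp⟩ := hP n (Nat.lt_succ_self n)
    obtain ⟨d, hd⟩ := hD n (Nat.lt_succ_self n)
    have hblock := forall_mem_uIcc (Q := Q) p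
    have hmem := mem (Q := Q) d
    rw [hp] at hblock
    rw [hd] at hmem
    exact (hblock.and (ih (fun k hk => hP k (hk.trans (Nat.lt_succ_self n)))
      fun k hk => hD k (hk.trans (Nat.lt_succ_self n)))).or
      (hblock.not.and ((hmem.and lt).or (hmem.not.and gt)))

end DefinableWith

theorem msoDefinable_lexRel {C : Type u} [LinearOrder C] (P D : ℕ → Set C) (n : ℕ) :
    MSODefinable C (lexRel P D n) := by
  obtain ⟨φ, hφ⟩ := DefinableWith.lexRel (P := P) (D := D) (n := n)
    (Q := fun j : Fin (n + n) => Fin.append (fun k : Fin n => P k) (fun k : Fin n => D k) j)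
    (fun k hk => ⟨Fin.castAdd n ⟨k, hk⟩, Fin.append_left _ _ _⟩)
    (fun k hk => ⟨Fin.natAdd n ⟨k, hk⟩, Fin.append_right _ _ _⟩)
  exact ⟨n + n, φ, _, fun x y => (hφ x y).symm⟩

theorem lexRel_congr {C : Type u} [LinearOrder C] {P D P' D' : ℕ → Set C} {n : ℕ}
    (hP : ∀ k < n, P k = P' k) (hD : ∀ k < n, D k = D' k) (x y : C) :
    lexRel P D n x y ↔ lexRel P' D' n x y := by
  induction n with
  | zero => rfl
  | succ n ih =>
    have h := ih (fun k hk => hP k (hk.trans (Nat.lt_succ_self n)))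
      fun k hk => hD k (hk.trans (Nat.lt_succ_self n))
    simp only [lexRel, hP n (Nat.lt_succ_self n), hD n (Nat.lt_succ_self n), h]

/-- Fibres of a monotone map are convex, so an interval between two points of a fibre stays in it,
and parameters glued from all fibres act there as the fibre's own. -/
theorem lexRel_fiber {C I : Type u} [LinearOrder C] [LinearOrder I] {f : C → I} (hf : Monotone f)
    (P D : ∀ i, ℕ → Set {x : C // f x = i}) (n : ℕ) (i : I) (x y : {x : C // f x = i}) :
    lexRel (fun k => {z : C | ⟨z, rfl⟩ ∈ P (f z) k}) (fun k => {z : C | ⟨z, rfl⟩ ∈ D (f z) k})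
      n x y ↔ lexRel (P i) (D i) n x y := by
  have hmem : ∀ (A : ∀ i, ℕ → Set {x : C // f x = i}) (k : ℕ) (z : {x : C // f x = i}),
      (z : C) ∈ {z : C | ⟨z, rfl⟩ ∈ A (f z) k} ↔ z ∈ A i k := by
    rintro A k ⟨z, rfl⟩
    rfl
  induction n with
  | zero => rfl
  | succ n ih =>
    have hblock : (∀ z ∈ Set.uIcc (x : C) y,
        z ∈ {z : C | ⟨z, rfl⟩ ∈ P (f z) n} ↔ (x : C) ∈ {z : C | ⟨z, rfl⟩ ∈ P (f z) n}) ↔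
        ∀ z ∈ Set.uIcc x y, z ∈ P i n ↔ x ∈ P i n := by
      constructor
      · intro h z hz
        rw [← hmem, ← hmem]
        refine h z ?_
        rw [Set.mem_uIcc] at hz ⊢
        exact hz
      · intro h z hz
        have hzi : f z = i := by
          rw [Set.mem_uIcc] at hz
          rcases hz with hz | hz
          · exact le_antisymm ((hf hz.2).trans y.2.le) (x.2.ge.trans (hf hz.1))
          · exact le_antisymm ((hf hz.2).trans x.2.le) (y.2.ge.trans (hf hz.1))
        rw [hmem P n x, hmem P n ⟨z, hzi⟩]
        refine h ⟨z, hzi⟩ ?_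
        rw [Set.mem_uIcc] at hz ⊢
        exact hz
    exact or_congr (and_congr hblock ih) (and_congr (not_congr hblock)
      (or_congr (and_congr (hmem D n x) Iff.rfl) (and_congr (not_congr (hmem D n x)) Iff.rfl)))

/-- A well-ordered set can be split in two parts such that no two distinct points lie in an interval
that is contained in one part. -/
theorem exists_alternating_of_wellFoundedLT (I : Type u) [LinearOrder I] [WellFoundedLT I] :
    ∃ p : I → Prop, ∀ i j, i < j → ¬ ∀ k ∈ Set.Icc i j, p k ↔ p i := by
  -- `p` flips at each immediate successor and is false at elements without immediate predecessor.
  -- If `i < j`, the successor of `i` lies in `Set.Icc i j` and disagrees with `i`.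
  let p : I → Prop := (IsWellFounded.wf (r := ((· < ·) : I → I → Prop))).fix
    fun i ih => ∃ j, ∃ h : j < i, (∀ k, k < i → k ≤ j) ∧ ¬ ih j h
  have hp : ∀ i, p i ↔ ∃ j, ∃ _ : j < i, (∀ k, k < i → k ≤ j) ∧ ¬ p j := fun i =>
    iff_of_eq (WellFounded.fix_eq _ _ _)
  refine ⟨p, fun i j hij h => ?_⟩
  obtain ⟨i', hi', hmin⟩ := (IsWellFounded.wf (r := ((· < ·) : I → I → Prop))).has_min
    (Set.Ioi i) ⟨j, hij⟩
  have hle : ∀ k, k < i' → k ≤ i := fun k hk => not_lt.1 fun hik => hmin k hik hk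
  have h₁ := h i' ⟨le_of_lt hi', not_lt.1 (hmin j hij)⟩
  have h₂ : p i' ↔ ¬ p i := by
    rw [hp i']
    constructor
    · rintro ⟨k, hk, hk', hpk⟩
      rwa [le_antisymm (hk' i hi') (hle k hk)]
    · exact fun h => ⟨i, hi', hle, h⟩
  tauto

theorem exists_alternating (I : Type u) [LinearOrder I]
    (hI : WellFoundedLT I ∨ WellFoundedGT I) :
    ∃ p : I → Prop, ∀ i j, i ≠ j → ¬ ∀ k ∈ Set.uIcc i j, p k ↔ p i := by
  -- Comparing all pairs `k`, `l` makes the condition invariant under reversal.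
  have key : ∃ p : I → Prop, ∀ i j, i < j → ¬ ∀ k ∈ Set.Icc i j, ∀ l ∈ Set.Icc i j,
      p k ↔ p l := by
    rcases hI with hI | hI
    · obtain ⟨p, hp⟩ := exists_alternating_of_wellFoundedLT I
      exact ⟨p, fun i j hij h => hp i j hij fun k hk => h k hk i ⟨le_rfl, hij.le⟩⟩
    · obtain ⟨p, hp⟩ := exists_alternating_of_wellFoundedLT Iᵒᵈ
      refine ⟨fun i => p (OrderDual.toDual i), fun i j hij h => ?_⟩
      exact hp (OrderDual.toDual j) (OrderDual.toDual i) hij fun k hk =>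
        h (OrderDual.ofDual k) ⟨hk.2, hk.1⟩ j ⟨hij.le, le_rfl⟩
  obtain ⟨p, hp⟩ := key
  refine ⟨p, fun i j hij h => ?_⟩
  rcases lt_or_gt_of_ne hij with hlt | hlt
  · rw [Set.uIcc_of_le hlt.le] at h
    exact hp i j hlt fun k hk l hl => (h k hk).trans (h l hl).symm
  · rw [Set.uIcc_of_ge hlt.le] at h
    exact hp j i hlt fun k hk l hl => (h k hk).trans (h l hl).symm

theorem isWellOrder_of_fibers {C I : Type u} (f : C → I) (q : I → I → Prop) [IsWellOrder I q]
    (s : C → C → Prop) (hs : ∀ i, IsWellOrder {x : C // f x = i} fun x y => s x y)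
    (r : C → C → Prop) (hr : ∀ x y, r x y ↔ q (f x) (f y) ∨ f x = f y ∧ s x y) :
    IsWellOrder C r := by
  refine { wf := ?_, trichotomous := ?_ }
  · have hwf := WellFounded.psigma_lex (IsWellFounded.wf (r := q)) fun i => (hs i).wf
    refine Subrelation.wf ?_ (InvImage.wf
      (fun x : C => (⟨f x, x, rfl⟩ : Σ' i, {x : C // f x = i})) hwf)
    intro x y hxy
    rcases (hr x y).1 hxy with h | ⟨h, h'⟩
    · exact PSigma.Lex.left _ _ h
    · have hlex : ∀ (i : I) (y' : {x : C // f x = i}), f x = i → s x y' →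
          PSigma.Lex q (fun i (x y : {x : C // f x = i}) => s x y) ⟨f x, x, rfl⟩ ⟨i, y'⟩ := by
        rintro _ y' rfl hs'
        exact PSigma.Lex.right _ hs'
      exact hlex _ ⟨y, rfl⟩ h h'
  · intro x y hxy hyx
    rw [hr] at hxy hyx
    push Not at hxy hyx
    rcases trichotomous_of q (f x) (f y) with h | h | h
    · exact absurd h hxy.1
    · rcases (hs (f y)).toTrichotomous.rel_or_eq_or_rel_swap (a := ⟨x, h⟩) (b := ⟨y, rfl⟩) with
        h' | h' | h'
      · exact absurd h' (hxy.2 h)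
      · exact congrArg Subtype.val h'
      · exact absurd h' (hyx.2 h.symm)
    · exact absurd h hyx.1

theorem HdegLE.exists_isWellOrder_lexRel {n : ℕ} : ∀ (C : Type u) [LinearOrder C], HdegLE n C →
    ∃ P D : ℕ → Set C, IsWellOrder C (lexRel P D n) := by
  induction n with
  | zero =>
    intro C _ hC
    have : Finite C := hC
    exact ⟨fun _ => ∅, fun _ => ∅, inferInstanceAs (IsWellOrder C (· < ·))⟩
  | succ n ih =>
    have hprop : ∀ E L A B : Prop, (¬ E → (A ↔ B)) → (B → ¬ E) →
        (E ∧ L ∨ ¬ E ∧ A ↔ B ∨ E ∧ L) := by tauto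
    rintro C _ ⟨I, _, f, hI, hf, hfib⟩
    choose P D hPD using fun i => ih _ (hfib i)
    -- Indices with empty fibre are discarded: every flip of the alternating predicate must be
    -- witnessed by a point of `C`.
    have hJ : WellFoundedLT (Set.range f) ∨ WellFoundedGT (Set.range f) :=
      hI.imp (fun h => ⟨InvImage.wf Subtype.val h.wf⟩) fun h => ⟨InvImage.wf Subtype.val h.wf⟩
    obtain ⟨p, hp⟩ := exists_alternating (Set.range f) hJ
    let g : C → Set.range f := Set.rangeFactorization f
    have hg : Monotone g := fun x y hxy => hf hxy
    -- Level `n` codes the new decomposition, with `D' n` everything or nothing according to the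
    -- direction in which the indices are well-ordered. The lower levels glue the parameters of all
    -- summands.
    let P' : ℕ → Set C := fun k => if k = n then {z | p (g z)} else {z | ⟨z, rfl⟩ ∈ P (f z) k}
    let D' : ℕ → Set C := fun k =>
      if k = n then {_z | WellFoundedLT (Set.range f)} else {z | ⟨z, rfl⟩ ∈ D (f z) k}
    have hlow : ∀ x y, lexRel P' D' n x y ↔ lexRel (fun k => {z : C | ⟨z, rfl⟩ ∈ P (f z) k})
        (fun k => {z : C | ⟨z, rfl⟩ ∈ D (f z) k}) n x y :=
      lexRel_congr (fun k hk => if_neg hk.ne) (fun k hk => if_neg hk.ne)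
    have hblock : ∀ x y : C, (∀ z ∈ Set.uIcc x y, z ∈ P' n ↔ x ∈ P' n) ↔ f x = f y := by
      intro x y
      have hP' : P' n = {z | p (g z)} := if_pos rfl
      rw [hP']
      constructor
      · intro h
        by_contra hne
        refine hp (g x) (g y) (fun h => hne (congrArg Subtype.val h)) ?_
        rintro ⟨_, z, rfl⟩ hz
        have hz' : f z ∈ Set.uIcc (f x) (f y) := by
          rw [Set.mem_uIcc] at hz ⊢
          exact hz
        by_cases hzx : f z = f x
        · rw [show (⟨f z, z, rfl⟩ : Set.range f) = g x from Subtype.ext hzx]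
        by_cases hzy : f z = f y
        · rw [show (⟨f z, z, rfl⟩ : Set.range f) = g y from Subtype.ext hzy]
          exact h y Set.right_mem_uIcc
        · refine h z ?_
          rw [Set.mem_uIcc] at hz' ⊢
          refine hz'.imp (fun h => ⟨?_, ?_⟩) fun h => ⟨?_, ?_⟩
          · exact (hf.reflect_lt (lt_of_le_of_ne h.1 (Ne.symm hzx))).le
          · exact (hf.reflect_lt (lt_of_le_of_ne h.2 hzy)).le
          · exact (hf.reflect_lt (lt_of_le_of_ne h.1 (Ne.symm hzy))).le
          · exact (hf.reflect_lt (lt_of_le_of_ne h.2 hzx)).le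
      · intro h z hz
        have hzx : f z = f x := by
          rw [Set.mem_uIcc] at hz
          rcases hz with hz | hz
          · exact le_antisymm ((hf hz.2).trans h.ge) (hf hz.1)
          · exact le_antisymm (hf hz.2) (h.le.trans (hf hz.1))
        change p (g z) ↔ p (g x)
        rw [show g z = g x from Subtype.ext hzx]
    have hD' : ∀ x, x ∈ D' n ↔ WellFoundedLT (Set.range f) := fun x => by
      rw [show D' n = {_z | WellFoundedLT (Set.range f)} from if_pos rfl]
      rfl
    have hs : ∀ i, IsWellOrder {x : C // g x = i} fun x y => lexRel P' D' n x y := by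
      rintro ⟨i, hi⟩
      have h := hPD i
      let e : {x : C // g x = ⟨i, hi⟩} → {x : C // f x = i} := fun x =>
        ⟨x, congrArg Subtype.val x.2⟩
      have he : Function.Injective e := fun x y hxy => Subtype.ext (congrArg (fun z => z.1) hxy)
      have hemb : ∀ x y : {x : C // g x = ⟨i, hi⟩}, lexRel P' D' n (x : C) (y : C) ↔ lexRel (P i) (D i) n (e x) (e y) :=
        fun x y => (hlow _ _).trans (lexRel_fiber hf P D n i (e x) (e y))
      exact (RelEmbedding.mk ⟨e, he⟩ fun {x y} => (hemb x y).symm :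
        (fun x y : {x : C // g x = ⟨i, hi⟩} => lexRel P' D' n x y) ↪r
          lexRel (P i) (D i) n).isWellOrder
    refine ⟨P', D', ?_⟩
    by_cases hlt : WellFoundedLT (Set.range f)
    · refine isWellOrder_of_fibers g (· < ·) (lexRel P' D' n) hs _ fun x y => ?_
      have hgf : g x = g y ↔ f x = f y := Subtype.ext_iff
      have hgt : g x < g y ↔ f x < f y := Iff.rfl
      have hne : f x ≠ f y → (x < y ↔ f x < f y) := fun hne =>
        ⟨fun h => lt_of_le_of_ne (hf h.le) hne, fun h => hf.reflect_lt h⟩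
      have hlt_ne : f x < f y → f x ≠ f y := fun h => h.ne
      have hstep : lexRel P' D' (n + 1) x y ↔ f x = f y ∧ lexRel P' D' n x y ∨
          f x ≠ f y ∧ x < y := by
        simp only [lexRel, hblock, hD', hlt]
        simp
      rw [hstep, hgf, hgt]
      exact hprop _ _ _ _ hne hlt_ne
    · have := hJ.resolve_left hlt
      refine isWellOrder_of_fibers g (· > ·) (lexRel P' D' n) hs _ fun x y => ?_
      have hgf : g x = g y ↔ f x = f y := Subtype.ext_iff
      have hgt : g x > g y ↔ f y < f x := Iff.rfl
      have hne : f x ≠ f y → (y < x ↔ f y < f x) := fun hne =>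
        ⟨fun h => lt_of_le_of_ne (hf h.le) (Ne.symm hne), fun h => hf.reflect_lt h⟩
      have hlt_ne : f y < f x → f x ≠ f y := fun h => h.ne'
      have hstep : lexRel P' D' (n + 1) x y ↔ f x = f y ∧ lexRel P' D' n x y ∨
          f x ≠ f y ∧ y < x := by
        simp only [lexRel, hblock, hD', hlt]
        simp
      rw [hstep, hgf, hgt]
      exact hprop _ _ _ _ hne hlt_ne

theorem IsTameChain.exists_hasDefinableWellOrderOfType {C : Type u} [LinearOrder C]
    (hC : IsTameChain C) : ∃ o : Ordinal.{u}, HasDefinableWellOrderOfType C o := by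
  obtain ⟨-, n, hn⟩ := hC
  obtain ⟨P, D, h⟩ := HdegLE.exists_isWellOrder_lexRel C hn
  exact ⟨_, _, h, msoDefinable_lexRel P D n, rfl⟩

end Existence

/-! ### Conclusion. -/

theorem proposition4p8 (C : Type u) [LinearOrder C] [Nonempty C] (hC : IsTameChain C) :
    (∃! v : ℕ∞, IsLog C v) ∧
    ((∃ k : ℕ, ∀ o : Ordinal.{u}, HasDefinableWellOrderOfType C o →
        Ordinal.omega0 ^ (k : Ordinal.{u}) ≤ o ∧
          o < Ordinal.omega0 ^ ((k + 1 : ℕ) : Ordinal.{u})) ∨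
      ∀ o : Ordinal.{u}, HasDefinableWellOrderOfType C o →
        Ordinal.omega0 ^ Ordinal.omega0 ≤ o) := by
  obtain ⟨o, ho⟩ := hC.exists_hasDefinableWellOrderOfType
  by_cases hfin : ∃ k : ℕ, o < Ordinal.omega0 ^ (k : Ordinal.{u})
  · classical
    obtain ⟨k, hk⟩ : ∃ k, Nat.find hfin = k + 1 := by
      refine Nat.exists_eq_succ_of_ne_zero fun h0 => ?_
      have h1 := Nat.find_spec hfin
      rw [h0] at h1
      obtain ⟨r, _, hr, rfl⟩ := ho
      exact not_type_lt_opow_zero h1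
    have hlt : o < Ordinal.omega0 ^ ((k + 1 : ℕ) : Ordinal.{u}) := hk ▸ Nat.find_spec hfin
    have hge : ¬ o < Ordinal.omega0 ^ (k : Ordinal.{u}) :=
      Nat.find_min hfin (hk ▸ Nat.lt_succ_self k)
    have hall : ∀ o' : Ordinal.{u}, HasDefinableWellOrderOfType C o' →
        Ordinal.omega0 ^ (k : Ordinal.{u}) ≤ o' ∧
          o' < Ordinal.omega0 ^ ((k + 1 : ℕ) : Ordinal.{u}) := fun o' ho' =>
      ⟨not_lt.1 fun h => hge (ho'.lt_opow_of_lt_opow ho h), ho.lt_opow_of_lt_opow ho' hlt⟩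
    refine ⟨⟨k, Or.inr ⟨k, rfl, o, ho, hall o ho⟩, ?_⟩, Or.inl ⟨k, hall⟩⟩
    rintro v (⟨-, o', ho', hle⟩ | ⟨l, rfl, o', ho', hle, hlt'⟩)
    · have h : Ordinal.omega0 ^ ((k + 1 : ℕ) : Ordinal.{u}) ≤ o' :=
        (Ordinal.opow_le_opow_right Ordinal.omega0_pos (Ordinal.natCast_lt_omega0 _).le).trans hle
      exact absurd (hall o' ho').2 h.not_gt
    · have h₁ := hle.trans_lt (hall o' ho').2
      have h₂ := (hall o' ho').1.trans_lt hlt'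
      rw [Ordinal.opow_lt_opow_iff_right Ordinal.one_lt_omega0, Nat.cast_lt] at h₁ h₂
      have : l = k := by omega
      rw [this]
  -- A definable well-ordering of type below some `ω ^ k` would force `o` below it too.
  · have hall : ∀ o' : Ordinal.{u}, HasDefinableWellOrderOfType C o' →
        ∀ k : ℕ, Ordinal.omega0 ^ (k : Ordinal.{u}) ≤ o' := fun o' ho' k =>
      not_lt.1 fun h => hfin ⟨k, ho'.lt_opow_of_lt_opow ho h⟩
    have hinf : ∀ o' : Ordinal.{u}, HasDefinableWellOrderOfType C o' →
        Ordinal.omega0 ^ Ordinal.omega0 ≤ o' := by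
      intro o' ho'
      rw [Ordinal.opow_le_of_isSuccLimit Ordinal.omega0_ne_zero Ordinal.isSuccLimit_omega0]
      intro b hb
      obtain ⟨k, rfl⟩ := Ordinal.lt_omega0.1 hb
      exact hall o' ho' k
    refine ⟨⟨⊤, Or.inl ⟨rfl, o, ho, hinf o ho⟩, ?_⟩, Or.inr hinf⟩
    rintro v (⟨rfl, -⟩ | ⟨l, rfl, o', ho', -, hlt⟩)
    · rfl
    · exact absurd hlt (hall o' ho' (l + 1)).not_gt
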